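/- **Definitions.** A *graph* is a locally finite CW complex of dimension at most one; its $0$-cells are vertices, its (open) $1$-cells are edges, and a subgraph is a closed union of cells. A *graph map* is a continuous map between graphs that sends vertices to vertices and sends each edge, up to reparametrization, to a finite (possibly constant) edge path. A *neighborhood basis of an end* of $\Gamma$ is a nested sequence $U_0\supseteq U_1\supseteq\cdots$ such that each $U_n$ is a connected component of $\Gamma\smallsetminus K_n$ for some increasing sequence $K_0\subseteq K_1\subseteq\cdots$ of compact sets that eventually contains every compact subset of $\Gamma$; two such sequences define the same *end* if each is cofinal in the other. A *neighborhood* of an end $E$ is an open set that contains a tail of every neighborhood basis of $E$ and meets only finitely many terms of any neighborhood basis of any other end. A graph map $g:\Gamma\to\Gamma$ is *end-periodic* if each end $E$ has a neighborhood $U_E$ such that $g$ restricts, on the largest subgraph contained in $\bigcup_E U_E$, to a homeomorphism onto its image that sends edges to edges, and such that for some integer $p>0$ every end $E$ satisfies one of the following: * $g^{p}(U_E)\subsetneq U_E$ and $\bigl(g^{pn}(U_E)\bigr)_{n\ge 0}$ is a neighborhood basis of $E$; * $g^{-p}(U_E)\subsetneq U_E$ and $\bigl(g^{-pn}(U_E)\bigr)_{n\ge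 0}$ is a neighborhood basis of $E$, where $g^{-k}(U)$ denotes the preimage of $U$ under $g^k$. Two continuous maps are *properly homotopic* if there is a homotopy $[0,1]\times\Gamma\to\Gamma$ between them which is a proper map. A *proper homotopy equivalence* is a proper map $f$ for which there is a proper map $f'$ such that $ff'$ and $f'f$ are properly homotopic to the identity; the *mapping class group* $\mathrm{Maps}(\Gamma)$ is the group of proper homotopy equivalences $\Gamma\to\Gamma$ up to proper homotopy. **Theorem.** Let $\Gamma$ be an infinite connected graph and let $g:\Gamma\to\Gamma$ be an end-periodic graph map that is a homotopy equivalence. Then there is a homotopy inverse $g':\Gamma\to\Gamma$ of $g$ which is itself end-periodic and which restricts to $g^{-1}$ on a neighborhood of each end, i.e. every end of $\Gamma$ has a neighborhood $N$ such that $g^{-1}(\{x\})=\{g'(x)\}$ for all $x\in N$. Moreover, $g'$ can be chosen so that $g$ and $g'$ are proper and $gg'$ and $g'g$ are properly homotopic to the identity. Consequently $g$ and $g'$ are proper homotopy equivalences, and they define mutually inverse mapping classes $[g],[g']=[g]^{-1}\in\mathrm{Maps}(\Gamma)$. -/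

import Mathlib

open Set Topology Topology.CWComplex
open scoped unitInterval

universe u

/-! ## Graphs -/

/-- A graph is a Hausdorff space with the structure of a locally finite CW complex of dimension at
most one.  (Loops and multiple edges are allowed.) -/
class IsTopGraph (X : Type u) [TopologicalSpace X] [CWComplex (univ : Set X)] : Prop where
  t2 : T2Space X
  dim_le_one : ∀ n : ℕ, 2 ≤ n → IsEmpty (cell (univ : Set X) n)
  locallyFinite :
    LocallyFinite fun c : Σ n, cell (univ : Set X) n => closedCell (C := univ) c.1 c.2

section Graph

variable (X : Type u) [TopologicalSpace X] [CWComplex (univ : Set X)]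

/-- The set of vertices: the union of the `0`-cells. -/
def graphVertices : Set X := ⋃ v : cell (univ : Set X) 0, openCell 0 v

variable {X}

/-- The characteristic map of the edge `e`, as a map on `[0, 1]`. -/
noncomputable def edgeParam (e : cell (univ : Set X) 1) (t : I) : X :=
  map (C := univ) 1 e fun _ => 2 * (t : ℝ) - 1

/-- A map `γ : [0, 1] → X` is an edge path (up to reparametrization): either it is constant at a
vertex (length `0`), or `[0, 1]` can be subdivided into `r ≥ 1` intervals such that `γ` is
continuous and traverses exactly one (open) edge, monotonically, on the interior of each of them. -/
def IsEdgePath (γ : I → X) : Prop :=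
  Continuous γ ∧
    ((∃ v ∈ graphVertices X, ∀ t, γ t = v) ∨
      ∃ (r : ℕ) (s : Fin (r + 1) → I), StrictMono s ∧ s 0 = 0 ∧ s (Fin.last r) = 1 ∧
        ∀ i : Fin r, ∃ e : cell (univ : Set X) 1,
          BijOn γ (Ioo (s i.castSucc) (s i.succ)) (openCell 1 e))

/-- A graph map: a continuous map sending vertices to vertices and edges to edge paths. -/
def IsGraphMap (g : C(X, X)) : Prop :=
  MapsTo g (graphVertices X) (graphVertices X) ∧
    ∀ e : cell (univ : Set X) 1, IsEdgePath fun t => g (edgeParam e t)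

/-- The largest subgraph contained in `U`: the union of all closed cells contained in `U`. -/
def largestSubgraph (U : Set X) : Set X :=
  ⋃ (n : ℕ) (e : cell (univ : Set X) n) (_ : closedCell n e ⊆ U), closedCell n e

end Graph

/-! ## Ends -/

section Ends

variable (X : Type u) [TopologicalSpace X]

/-- `U` is a (nested) sequence of connected components of the complements of the terms of an
exhaustion of `X` by compact sets. -/
def IsEndBasis (U : ℕ → Set X) : Prop :=
  Antitone U ∧ ∃ K : ℕ → Set X, Monotone K ∧ (∀ n, IsCompact (K n)) ∧
    (∀ C, IsCompact C → ∃ n, C ⊆ K n) ∧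
    ∀ n, ∃ x ∈ (K n)ᶜ, U n = connectedComponentIn (K n)ᶜ x

/-- Two neighborhood bases are equivalent if each is cofinal in the other. -/
def endSetoid : Setoid {U : ℕ → Set X // IsEndBasis X U} where
  r U V := ∀ n, (∃ i, U.1 i ⊆ V.1 n) ∧ ∃ j, V.1 j ⊆ U.1 n
  iseqv :=
    { refl := fun _ n => ⟨⟨n, subset_rfl⟩, n, subset_rfl⟩
      symm := fun h n => ⟨(h n).2, (h n).1⟩
      trans := by
        intro U V W h k n
        obtain ⟨i, hi⟩ := (k n).1
        obtain ⟨i', hi'⟩ := (h i).1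
        obtain ⟨j, hj⟩ := (h n).2
        obtain ⟨j', hj'⟩ := (k j).2
        exact ⟨⟨i', hi'.trans hi⟩, j', hj'.trans hj⟩ }

/-- The set of ends of `X`. -/
def GraphEnd : Type u := Quotient (endSetoid X)

variable {X}

/-- `U` is a neighborhood basis for the end `E`. -/
def IsBasisOfEnd (U : ℕ → Set X) (E : GraphEnd X) : Prop :=
  ∃ h : IsEndBasis X U, Quotient.mk (endSetoid X) ⟨U, h⟩ = E

/-- `U` is a neighborhood of the end `E`: it is open, contains a tail of every neighborhood basis
of `E`, and meets only finitely many terms of any neighborhood basis of any other end. -/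
def IsEndNhd (U : Set X) (E : GraphEnd X) : Prop :=
  IsOpen U ∧
    (∀ B : ℕ → Set X, IsBasisOfEnd B E → ∃ N, ∀ n ≥ N, B n ⊆ U) ∧
    ∀ F : GraphEnd X, F ≠ E → ∀ B : ℕ → Set X, IsBasisOfEnd B F → {n | (U ∩ B n).Nonempty}.Finite

end Ends

/-! ## End-periodic maps -/

/-- End-periodic graph maps. Negative powers are preimages: `g^{-k}(U) = (g^[k]) ⁻¹' U`. -/
def IsEndPeriodic {X : Type u} [TopologicalSpace X] [CWComplex (univ : Set X)] (g : C(X, X)) :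
    Prop :=
  IsGraphMap g ∧ ∃ U : GraphEnd X → Set X,
    (∀ E, IsEndNhd (U E) E) ∧
    -- `g` restricts to a homeomorphism onto its image on the largest subgraph of `⋃ E, U E`
    IsEmbedding ((largestSubgraph (⋃ E, U E)).domRestrict g) ∧
    -- and sends edges of this subgraph to edges
    (∀ e : cell (univ : Set X) 1, openCell 1 e ⊆ largestSubgraph (⋃ E, U E) →
      ∃ e' : cell (univ : Set X) 1, g '' openCell 1 e = openCell 1 e') ∧
    ∃ p : ℕ, 0 < p ∧ ∀ E,
      (g^[p] '' U E ⊂ U E ∧ IsBasisOfEnd (fun n => g^[p * n] '' U E) E) ∨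
      (g^[p] ⁻¹' U E ⊂ U E ∧ IsBasisOfEnd (fun n => g^[p * n] ⁻¹' U E) E)

/-! ## Homotopy inverses, proper homotopy equivalences and mapping classes -/

section Homotopy

variable {X : Type u} [TopologicalSpace X]

/-- `g'` is a homotopy inverse of `g`. -/
def IsHomotopyInverse (g g' : C(X, X)) : Prop :=
  (g'.comp g).Homotopic (ContinuousMap.id X) ∧ (g.comp g').Homotopic (ContinuousMap.id X)

/-- `g` is a homotopy equivalence. -/
def IsHomotopyEquivalence (g : C(X, X)) : Prop := ∃ g', IsHomotopyInverse g g'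

/-- Proper homotopy: a homotopy `[0, 1] × X → X` that is a proper map. -/
def ProperHomotopic (f g : C(X, X)) : Prop := ∃ H : f.Homotopy g, IsProperMap H

/-- `f` and `f'` are proper and inverse to each other up to proper homotopy. -/
def IsProperHomotopyInverse (f f' : C(X, X)) : Prop :=
  IsProperMap f ∧ IsProperMap f' ∧
    ProperHomotopic (f.comp f') (ContinuousMap.id X) ∧
    ProperHomotopic (f'.comp f) (ContinuousMap.id X)

/-- Proper homotopy equivalences. -/
def IsProperHomotopyEquivalence (f : C(X, X)) : Prop := ∃ f', IsProperHomotopyInverse f f'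

theorem ProperHomotopic.refl {f : C(X, X)} (hf : IsProperMap f) : ProperHomotopic f f :=
  ⟨ContinuousMap.Homotopy.refl f, hf.comp isProperMap_snd_of_compactSpace⟩

theorem ProperHomotopic.symm {f g : C(X, X)} (h : ProperHomotopic f g) : ProperHomotopic g f := by
  obtain ⟨H, hH⟩ := h
  exact ⟨H.symm, hH.comp (unitInterval.symmHomeomorph.isProperMap.prodMap isProperMap_id)⟩

theorem isProperMap_sumElim {Y Z W : Type*} [TopologicalSpace Y] [TopologicalSpace Z]
    [TopologicalSpace W] {f : Y → W} {g : Z → W} (hf : IsProperMap f) (hg : IsProperMap g) :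
    IsProperMap (Sum.elim f g) := by
  rw [isProperMap_iff_isClosedMap_and_compact_fibers] at *
  refine ⟨hf.1.sumElim hg.1, isClosedMap_sum.2 ⟨hf.2.1, hg.2.1⟩, fun y => ?_⟩
  rw [show Sum.elim f g ⁻¹' {y} = Sum.inl '' (f ⁻¹' {y}) ∪ Sum.inr '' (g ⁻¹' {y}) by
    ext (x | x) <;> simp]
  exact ((hf.2.2 y).image continuous_inl).union ((hg.2.2 y).image continuous_inr)

theorem ProperHomotopic.trans {f g h : C(X, X)} (h₁ : ProperHomotopic f g)
    (h₂ : ProperHomotopic g h) : ProperHomotopic f h := by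
  obtain ⟨H, hH⟩ := h₁
  obtain ⟨K, hK⟩ := h₂
  refine ⟨H.trans K, ?_⟩
  let a : I → I := fun t => ⟨t / 2, by constructor <;> linarith [t.2.1, t.2.2]⟩
  let b : I → I := fun t => ⟨(1 + t) / 2, by constructor <;> linarith [t.2.1, t.2.2]⟩
  have ha : Continuous a := by fun_prop
  have hb : Continuous b := by fun_prop
  let j : (I × X) ⊕ (I × X) → I × X :=
    Sum.elim (fun q => (a q.1, q.2)) (fun q => (b q.1, q.2))
  have hj : Continuous j := Continuous.sumElim (by fun_prop) (by fun_prop)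
  have hs : Function.Surjective j := by
    rintro ⟨t, x⟩
    by_cases ht : (t : ℝ) ≤ 1 / 2
    · refine ⟨Sum.inl (⟨2 * t, by constructor <;> linarith [t.2.1]⟩, x), ?_⟩
      simp [j, a]
    · refine ⟨Sum.inr (⟨2 * t - 1, by constructor <;> linarith [t.2.2]⟩, x), ?_⟩
      simp [j, b]
  refine isProperMap_of_comp_of_surj hj (H.trans K).continuous ?_ hs
  have : (H.trans K) ∘ j = Sum.elim H K := by
    ext (⟨t, x⟩ | ⟨t, x⟩)
    · have h1 : (t : ℝ) / 2 ≤ 1 / 2 := by linarith [t.2.2]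
      simp only [Function.comp, j, a, Sum.elim_inl, ContinuousMap.Homotopy.trans_apply]
      rw [dif_pos h1]
      congr 2
      ext
      simp only
      ring
    · simp only [Function.comp, j, b, Sum.elim_inr, ContinuousMap.Homotopy.trans_apply]
      split_ifs with h1
      · have h0 : t = 0 := by
          ext
          simp only [Icc.coe_zero]
          linarith [t.2.1]
        subst h0
        have e : (⟨2 * ((1 + ((0 : I) : ℝ)) / 2), by simp⟩ : I) = 1 := by
          ext
          simp
        simp
      · congr 2
        ext
        simp only
        ring
  rw [this]
  exact isProperMap_sumElim hH hK

theorem ProperHomotopic.comp {f₀ f₁ g₀ g₁ : C(X, X)} (hf : ProperHomotopic f₀ f₁)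
    (hg : ProperHomotopic g₀ g₁) (pf : IsProperMap f₁) (pg : IsProperMap g₀) :
    ProperHomotopic (g₀.comp f₀) (g₁.comp f₁) := by
  obtain ⟨H, hH⟩ := hf
  obtain ⟨K, hK⟩ := hg
  refine ProperHomotopic.trans (g := g₀.comp f₁)
    ⟨⟨⟨fun q => g₀ (H q), by fun_prop⟩, by simp, by simp⟩, pg.comp hH⟩
    ⟨⟨⟨fun q => K (q.1, f₁ q.2), by fun_prop⟩, by simp, by simp⟩, ?_⟩
  exact hK.comp (isProperMap_id.prodMap pf)

theorem IsProperHomotopyEquivalence.isProperMap {f : C(X, X)}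
    (hf : IsProperHomotopyEquivalence f) : IsProperMap f := by
  obtain ⟨_, h, _⟩ := hf
  exact h

theorem IsProperHomotopyInverse.symm {f f' : C(X, X)} (h : IsProperHomotopyInverse f f') :
    IsProperHomotopyInverse f' f := ⟨h.2.1, h.1, h.2.2.2, h.2.2.1⟩

theorem IsProperHomotopyInverse.comp {f f' g g' : C(X, X)} (hf : IsProperHomotopyInverse f f')
    (hg : IsProperHomotopyInverse g g') : IsProperHomotopyInverse (g.comp f) (f'.comp g') := by
  have key : ∀ {f f' g g' : C(X, X)}, IsProperHomotopyInverse f f' →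
      IsProperHomotopyInverse g g' →
      ProperHomotopic ((g.comp f).comp (f'.comp g')) (ContinuousMap.id X) := by
    intro f f' g g' hf hg
    have h₁ : ProperHomotopic ((f.comp f').comp g') ((ContinuousMap.id X).comp g') :=
      ProperHomotopic.comp (.refl hg.2.1) hf.2.2.1 hg.2.1 (hf.1.comp hf.2.1)
    have h₂ : ProperHomotopic (g.comp ((f.comp f').comp g')) (g.comp g') :=
      ProperHomotopic.comp h₁ (.refl hg.1) hg.2.1 hg.1
    exact h₂.trans hg.2.2.1
  exact ⟨hg.1.comp hf.1, hf.2.1.comp hg.2.1, key hf hg, key hg.symm hf.symm⟩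

theorem isProperHomotopyInverse_id :
    IsProperHomotopyInverse (ContinuousMap.id X) (ContinuousMap.id X) :=
  ⟨isProperMap_id, isProperMap_id, .refl isProperMap_id, .refl isProperMap_id⟩

variable (X)

/-- Proper homotopy equivalences of `X`, up to proper homotopy. -/
def properHomotopySetoid : Setoid {f : C(X, X) // IsProperHomotopyEquivalence f} where
  r f g := ProperHomotopic f.1 g.1
  iseqv := ⟨fun f => .refl f.2.isProperMap, fun h => h.symm, fun h k => h.trans k⟩

/-- The mapping class group of `X`: proper homotopy equivalences up to proper homotopy. -/
def MappingClassGroup : Type u := Quotient (properHomotopySetoid X)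

variable {X}

/-- The mapping class of a proper homotopy equivalence. -/
def MappingClassGroup.mk (f : C(X, X)) (hf : IsProperHomotopyEquivalence f) :
    MappingClassGroup X :=
  Quotient.mk (properHomotopySetoid X) ⟨f, hf⟩

theorem IsProperHomotopyInverse.properHomotopic {f f' g g' : C(X, X)}
    (hf : IsProperHomotopyInverse f f') (hg : IsProperHomotopyInverse g g')
    (h : ProperHomotopic f g) : ProperHomotopic f' g' := by
  have h₁ : ProperHomotopic ((g'.comp g).comp f') f' :=
    ProperHomotopic.comp (.refl hf.2.1) hg.2.2.2 hf.2.1 (hg.2.1.comp hg.1)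
  have h₂ : ProperHomotopic (f.comp f') (g.comp f') :=
    ProperHomotopic.comp (.refl hf.2.1) h hf.2.1 hf.1
  have h₃ : ProperHomotopic (g.comp f') (ContinuousMap.id X) := h₂.symm.trans hf.2.2.1
  have h₄ : ProperHomotopic (g'.comp (g.comp f')) (g'.comp (ContinuousMap.id X)) :=
    ProperHomotopic.comp h₃ (.refl hg.2.1) isProperMap_id hg.2.1
  exact h₁.symm.trans h₄

/-- Multiplication is induced by composition, inversion by proper homotopy inverses. -/
noncomputable instance : Group (MappingClassGroup X) where
  mul := Quotient.map₂ (fun g f => ⟨g.1.comp f.1, by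
      obtain ⟨g', hg⟩ := g.2
      obtain ⟨f', hf⟩ := f.2
      exact ⟨_, hf.comp hg⟩⟩)
    (fun g₀ _ hg _ f₁ hf => ProperHomotopic.comp hf hg f₁.2.isProperMap g₀.2.isProperMap)
  one := MappingClassGroup.mk (ContinuousMap.id X) ⟨_, isProperHomotopyInverse_id⟩
  inv := Quotient.map (fun f => ⟨f.2.choose, ⟨f.1, f.2.choose_spec.symm⟩⟩)
    (fun f g h => f.2.choose_spec.properHomotopic g.2.choose_spec h)
  mul_assoc := by
    rintro ⟨f⟩ ⟨g⟩ ⟨h⟩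
    rfl
  one_mul := by
    rintro ⟨f⟩
    rfl
  mul_one := by
    rintro ⟨f⟩
    rfl
  inv_mul_cancel := by
    rintro ⟨f⟩
    exact Quotient.sound f.2.choose_spec.2.2.2

end Homotopy

/-! Near infinity `g` is invertible for combinatorial reasons; on the remaining compact part a
homotopy inverse is built by hand, using that a homotopy equivalence is fully faithful on
fundamental groupoids.

Invertibility near infinity. The subgraph on which `g` is an embedding carrying cells to cells has
relatively compact complement, because a set that is not relatively compact accumulates at some end
(`exists_basis_inter_nonempty`). Only finitely many cells meet a compact set and `g` is injective on
the cells near infinity, so `g` is proper. It also covers a neighborhood of every end. At an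
attracting end, `g^p(U)` is a term of a neighborhood basis. At a repelling end, `g^p` injects each
layer of cells of the basis into the previous one; the layers are finite, so their sizes stabilize
and the injections become bijections (`exists_subset_range_of_preimage`). This gives a closed
subgraph `Y` with relatively compact complement over which `g` is bijective and cellular
(`IsEndPeriodic.exists_isInvertibleOver`).

The inverse. Over `Y` take `g' = g⁻¹`. Send the other vertices `y` to arbitrary vertices `k y`, with
a path from `y` to `g (k y)`. Fullness yields, for each edge not in `Y`, a path class whose image
under `g` closes up the square formed by that edge and the two chosen paths; it is represented by an
edge path (`exists_isEdgePath`), and filling the squares gives a homotopy from the identity to `g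
g'`. Lifting the tracks of this homotopy through `g` gives the tracks of a homotopy from the
identity to `g' g`; its squares commute by faithfulness. Both homotopies are stationary off a
compact set, hence proper.

End-periodicity of `g'`. Far enough out, preimages under `g'` are images under `g` and conversely,
so attracting and repelling ends exchange roles and the period `p` is kept. -/

/-! ## The cells of a graph -/

section GraphBasics

variable {X : Type u} [TopologicalSpace X] [CWComplex (univ : Set X)]

/-- The affine parametrization of the one-dimensional ball by the unit interval. -/
noncomputable def ballParam (t : I) : Fin 1 → ℝ := fun _ => 2 * (t : ℝ) - 1

theorem continuous_ballParam : Continuous ballParam := by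
  unfold ballParam
  fun_prop

theorem ballParam_injective : Function.Injective ballParam := by
  intro s t h
  have := congrFun h 0
  simp only [ballParam] at this
  ext
  linarith

theorem ballParam_mem_closedBall (t : I) : ballParam t ∈ Metric.closedBall (0 : Fin 1 → ℝ) 1 := by
  rw [mem_closedBall_zero_iff, pi_norm_le_iff_of_nonneg zero_le_one]
  intro _
  rw [Real.norm_eq_abs, abs_le]
  simp only [ballParam]
  constructor <;> linarith [t.2.1, t.2.2]

theorem ballParam_image_univ : ballParam '' univ = Metric.closedBall (0 : Fin 1 → ℝ) 1 := by
  apply Subset.antisymm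
  · rintro _ ⟨t, -, rfl⟩
    exact ballParam_mem_closedBall t
  · intro f hf
    rw [mem_closedBall_zero_iff, pi_norm_le_iff_of_nonneg zero_le_one] at hf
    have h := hf 0
    rw [Real.norm_eq_abs, abs_le] at h
    refine ⟨⟨(f 0 + 1) / 2, by constructor <;> linarith⟩, mem_univ _, ?_⟩
    ext i
    rw [Subsingleton.elim i 0]
    simp [ballParam]
    ring

theorem ballParam_image_Ioo : ballParam '' Ioo 0 1 = Metric.ball (0 : Fin 1 → ℝ) 1 := by
  apply Subset.antisymm
  · rintro _ ⟨t, ht, rfl⟩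
    rw [mem_ball_zero_iff, pi_norm_lt_iff zero_lt_one]
    intro _
    rw [Real.norm_eq_abs, abs_lt]
    have h0 : (0 : ℝ) < t := ht.1
    have h1 : (t : ℝ) < 1 := ht.2
    simp only [ballParam]
    constructor <;> linarith
  · intro f hf
    rw [mem_ball_zero_iff, pi_norm_lt_iff zero_lt_one] at hf
    have h := hf 0
    rw [Real.norm_eq_abs, abs_lt] at h
    refine ⟨⟨(f 0 + 1) / 2, by constructor <;> linarith⟩, ⟨?_, ?_⟩, ?_⟩
    · change (0 : ℝ) < (f 0 + 1) / 2
      linarith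
    · change (f 0 + 1) / 2 < (1 : ℝ)
      linarith
    · ext i
      rw [Subsingleton.elim i 0]
      simp [ballParam]
      ring

theorem edgeParam_eq (e : cell (univ : Set X) 1) : edgeParam e = map 1 e ∘ ballParam := rfl

theorem continuous_edgeParam (e : cell (univ : Set X) 1) : Continuous (edgeParam e) := by
  rw [edgeParam_eq]
  exact (continuousOn 1 e).comp_continuous continuous_ballParam ballParam_mem_closedBall

theorem range_edgeParam (e : cell (univ : Set X) 1) : range (edgeParam e) = closedCell 1 e := by
  rw [← image_univ, edgeParam_eq, image_comp, ballParam_image_univ]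
  rfl

theorem bijOn_edgeParam (e : cell (univ : Set X) 1) :
    BijOn (edgeParam e) (Ioo 0 1) (openCell 1 e) := by
  have h : BijOn (map 1 e) (Metric.ball 0 1) (openCell 1 e) := by
    refine InjOn.bijOn_image ?_
    rw [← source_eq 1 e]
    exact (map 1 e).injOn
  have h' : BijOn ballParam (Ioo 0 1) (Metric.ball 0 1) := by
    rw [← ballParam_image_Ioo]
    exact ballParam_injective.injOn.bijOn_image
  exact h.comp h'

theorem edgeParam_mem_openCell (e : cell (univ : Set X) 1) {t : I} (ht : t ∈ Ioo (0 : I) 1) :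
    edgeParam e t ∈ openCell 1 e := (bijOn_edgeParam e).mapsTo ht

theorem edgeParam_mem_closedCell (e : cell (univ : Set X) 1) (t : I) :
    edgeParam e t ∈ closedCell 1 e := by
  rw [← range_edgeParam]
  exact mem_range_self t

theorem mem_graphVertices_iff {x : X} :
    x ∈ graphVertices X ↔ ∃ v : cell (univ : Set X) 0, openCell 0 v = {x} := by
  simp only [graphVertices, mem_iUnion]
  refine exists_congr fun v => ?_
  rw [RelCWComplex.openCell_zero_eq_singleton, mem_singleton_iff, singleton_eq_singleton_iff,
    eq_comm]

theorem cellFrontier_one_subset (e : cell (univ : Set X) 1) :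
    cellFrontier 1 e ⊆ graphVertices X := by
  obtain ⟨x, y, h⟩ := CWComplex.exists_cellFrontier_one_eq e
  rw [h, RelCWComplex.closedCell_zero_eq_singleton, RelCWComplex.closedCell_zero_eq_singleton]
  rintro z (rfl | rfl) <;> rw [mem_graphVertices_iff]
  exacts [⟨x, RelCWComplex.openCell_zero_eq_singleton⟩,
    ⟨y, RelCWComplex.openCell_zero_eq_singleton⟩]

theorem ballParam_zero_mem_sphere : ballParam 0 ∈ Metric.sphere (0 : Fin 1 → ℝ) 1 := by
  simp [ballParam, Pi.norm_def]

theorem ballParam_one_mem_sphere : ballParam 1 ∈ Metric.sphere (0 : Fin 1 → ℝ) 1 := by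
  simp only [ballParam, mem_sphere_iff_norm, sub_zero, Pi.norm_def]
  norm_num

theorem edgeParam_zero_mem (e : cell (univ : Set X) 1) : edgeParam e 0 ∈ graphVertices X :=
  cellFrontier_one_subset e ⟨_, ballParam_zero_mem_sphere, rfl⟩

theorem edgeParam_one_mem (e : cell (univ : Set X) 1) : edgeParam e 1 ∈ graphVertices X :=
  cellFrontier_one_subset e ⟨_, ballParam_one_mem_sphere, rfl⟩

theorem disjoint_openCell_graphVertices (e : cell (univ : Set X) 1) :
    Disjoint (openCell 1 e) (graphVertices X) := by
  rw [graphVertices, disjoint_iUnion_right]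
  intro v
  exact CWComplex.disjoint_openCell_of_ne (by simp)

theorem edgeParam_notMem_graphVertices (e : cell (univ : Set X) 1) {t : I}
    (ht : t ∈ Ioo (0 : I) 1) : edgeParam e t ∉ graphVertices X :=
  (disjoint_openCell_graphVertices e).notMem_of_mem_left (edgeParam_mem_openCell e ht)

theorem mem_Ioo_or_eq (t : I) : t = 0 ∨ t = 1 ∨ t ∈ Ioo (0 : I) 1 := by
  rcases eq_or_ne t 0 with h | h
  · exact .inl h
  rcases eq_or_ne t 1 with h' | h'
  · exact .inr (.inl h')
  exact .inr (.inr ⟨unitInterval.pos_iff_ne_zero.2 h, unitInterval.lt_one_iff_ne_one.2 h'⟩)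

theorem eq_of_openCell_inter {e e' : cell (univ : Set X) 1} {x : X} (h : x ∈ openCell 1 e)
    (h' : x ∈ openCell 1 e') : e = e' := by
  by_contra hne
  refine (CWComplex.disjoint_openCell_of_ne (C := (univ : Set X)) (i := e) (j := e')
    ?_).notMem_of_mem_left h h'
  simpa using hne

theorem edgeParam_eq_edgeParam {e e' : cell (univ : Set X) 1} {t t' : I} (ht : t ∈ Ioo (0 : I) 1)
    (h : edgeParam e t = edgeParam e' t') : e = e' ∧ t = t' := by
  have h0 : t' ∈ Ioo (0 : I) 1 := by
    rcases mem_Ioo_or_eq t' with rfl | rfl | h0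
    · exact absurd (h ▸ edgeParam_zero_mem e') (edgeParam_notMem_graphVertices e ht)
    · exact absurd (h ▸ edgeParam_one_mem e') (edgeParam_notMem_graphVertices e ht)
    · exact h0
  obtain rfl := eq_of_openCell_inter (edgeParam_mem_openCell e ht)
    (h ▸ edgeParam_mem_openCell e' h0)
  exact ⟨rfl, (bijOn_edgeParam e).injOn ht h0 h⟩

theorem exists_mem_openCell (x : X) : ∃ n, ∃ c : cell (univ : Set X) n, x ∈ openCell n c := by
  have h : x ∈ (univ : Set X) := mem_univ x
  rw [← CWComplex.iUnion_openCell_eq_complex (C := (univ : Set X))] at h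
  simpa only [mem_iUnion] using h

/-! ### The weak topology of a graph, and gluing along vertices -/

variable [IsTopGraph X]

instance (priority := 50) IsTopGraph.instT2Space : T2Space X := IsTopGraph.t2

theorem IsTopGraph.cell_cases {P : ∀ n, cell (univ : Set X) n → Prop} (h0 : ∀ v, P 0 v)
    (h1 : ∀ e, P 1 e) (n : ℕ) (c : cell (univ : Set X) n) : P n c := by
  match n, c with
  | 0, c => exact h0 c
  | 1, c => exact h1 c
  | n + 2, c => exact ((IsTopGraph.dim_le_one (X := X) (n + 2) (by omega)).false c).elim

theorem mem_graphVertices_or (x : X) :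
    x ∈ graphVertices X ∨ ∃ e, ∃ t ∈ Ioo (0 : I) 1, edgeParam e t = x := by
  obtain ⟨n, c, hc⟩ := exists_mem_openCell x
  revert hc
  refine IsTopGraph.cell_cases (P := fun n c => x ∈ openCell n c → _) (fun v hv => ?_)
    (fun e he => ?_) n c
  · left
    exact mem_iUnion.2 ⟨v, hv⟩
  · right
    exact ⟨e, (bijOn_edgeParam e).surjOn he⟩

/-- Closedness in a CW complex is tested on closed cells. The trace on a `0`-cell is finite, and the
trace on an edge is the image of a compact subset of `I`, hence closed in a Hausdorff space. -/
theorem isClosed_of_edgeParam {S : Set X} (h : ∀ e, IsClosed (edgeParam e ⁻¹' S)) :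
    IsClosed S := by
  rw [CWComplex.closed (univ : Set X) S (subset_univ S)]
  refine IsTopGraph.cell_cases (P := fun n c => IsClosed (S ∩ closedCell n c)) (fun v => ?_)
    (fun e => ?_)
  · rw [RelCWComplex.closedCell_zero_eq_singleton]
    exact (finite_singleton _).inter_of_right _ |>.isClosed
  · rw [← range_edgeParam, ← image_preimage_eq_inter_range]
    exact ((h e).isCompact.image (continuous_edgeParam e)).isClosed

theorem isOpen_of_edgeParam {S : Set X} (h : ∀ e, IsOpen (edgeParam e ⁻¹' S)) : IsOpen S := by
  rw [← isClosed_compl_iff]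
  refine isClosed_of_edgeParam fun e => ?_
  rw [preimage_compl]
  exact (h e).isClosed_compl

theorem continuous_of_edgeParam {W : Type*} [TopologicalSpace W] {f : X → W}
    (h : ∀ e, Continuous (f ∘ edgeParam e)) : Continuous f where
  isOpen_preimage _ hS := isOpen_of_edgeParam fun e => hS.preimage (h e)

/-- Maps on the edges that agree on the vertices glue. -/
theorem exists_continuousMap_glue {W : Type*} [TopologicalSpace W] (φ : X → W)
    (ψ : cell (univ : Set X) 1 → C(I, W)) (h0 : ∀ e, ψ e 0 = φ (edgeParam e 0))
    (h1 : ∀ e, ψ e 1 = φ (edgeParam e 1)) :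
    ∃ f : C(X, W), (∀ v ∈ graphVertices X, f v = φ v) ∧ ∀ e t, f (edgeParam e t) = ψ e t := by
  classical
  -- The choice is harmless: a point that is not a vertex determines its edge and its interior
  -- parameter.
  let f : X → W := fun x => if h : ∃ e, ∃ t ∈ Ioo (0 : I) 1, edgeParam e t = x then
    ψ h.choose h.choose_spec.choose else φ x
  have hv : ∀ v ∈ graphVertices X, f v = φ v := by
    intro v hv
    refine dif_neg ?_
    rintro ⟨e, t, ht, rfl⟩
    exact edgeParam_notMem_graphVertices e ht hv
  have he : ∀ e t, f (edgeParam e t) = ψ e t := by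
    intro e t
    rcases mem_Ioo_or_eq t with rfl | rfl | ht
    · rw [hv _ (edgeParam_zero_mem e), h0]
    · rw [hv _ (edgeParam_one_mem e), h1]
    · have h : ∃ e', ∃ t' ∈ Ioo (0 : I) 1, edgeParam e' t' = edgeParam e t := ⟨e, t, ht, rfl⟩
      have hf : f (edgeParam e t) = ψ h.choose h.choose_spec.choose := dif_pos h
      obtain ⟨h1, h2⟩ := edgeParam_eq_edgeParam h.choose_spec.choose_spec.1
        h.choose_spec.choose_spec.2
      rw [hf, h2, h1]
  refine ⟨⟨f, continuous_of_edgeParam fun e => ?_⟩, hv, he⟩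
  have : f ∘ edgeParam e = ψ e := funext (he e)
  rw [this]
  exact (ψ e).continuous

/-- Homotopies on the edges that agree on the vertices glue. -/
theorem exists_homotopy_glue {W : Type*} [TopologicalSpace W] (φ : X → C(I, W))
    (ψ : cell (univ : Set X) 1 → C(I × I, W)) (h0 : ∀ e s, ψ e (s, 0) = φ (edgeParam e 0) s)
    (h1 : ∀ e s, ψ e (s, 1) = φ (edgeParam e 1) s) :
    ∃ F : C(I × X, W), (∀ v ∈ graphVertices X, ∀ s, F (s, v) = φ v s) ∧
      ∀ e s t, F (s, edgeParam e t) = ψ e (s, t) := by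
  -- A homotopy is a map into the path space `C(I, W)`, so currying in the time variable reduces to
  -- gluing maps.
  obtain ⟨f, hv, he⟩ := exists_continuousMap_glue φ
    (fun e => ((ψ e).comp ⟨Prod.swap, continuous_swap⟩).curry)
    (fun e => by ext s; exact h0 e s) (fun e => by ext s; exact h1 e s)
  refine ⟨f.uncurry.comp ⟨Prod.swap, continuous_swap⟩, fun v hv' s => ?_, fun e s t => ?_⟩
  · change f v s = _
    rw [hv v hv']
  · change f (edgeParam e t) s = _
    rw [he]
    rfl

instance IsTopGraph.instLocallyPathConnectedSpace : LocallyPathConnectedSpace X := by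
  have : LocallyPathConnectedSpace I :=
    (isQuotientMap_projIcc (h := zero_le_one' ℝ)).locallyPathConnectedSpace
  rw [locallyPathConnectedSpace_iff_isOpen_pathComponentIn]
  intro x O hO
  refine isOpen_of_edgeParam fun e => ?_
  rw [isOpen_iff_mem_nhds]
  intro t ht
  have hO' : edgeParam e ⁻¹' O ∈ 𝓝 t :=
    (hO.preimage (continuous_edgeParam e)).mem_nhds
      (show edgeParam e t ∈ O from pathComponentIn_subset ht)
  obtain ⟨S, ⟨hS, hSc⟩, hSO⟩ := (path_connected_basis t).mem_iff.1 hO'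
  refine Filter.mem_of_superset hS fun s hs => ?_
  have h := hSc.joinedIn t (mem_of_mem_nhds hS) s hs
  have h' : JoinedIn O (edgeParam e t) (edgeParam e s) := by
    obtain ⟨γ, hγ⟩ := h
    exact ⟨γ.map (continuous_edgeParam e), fun r => hSO (hγ r)⟩
  exact JoinedIn.trans ht h'

end GraphBasics

/-! ## Compact sets and subgraphs -/

section Subgraphs

variable {X : Type u} [TopologicalSpace X] [CWComplex (univ : Set X)]

theorem mem_largestSubgraph {U : Set X} {x : X} : x ∈ largestSubgraph U ↔
    ∃ n, ∃ c : cell (univ : Set X) n, closedCell n c ⊆ U ∧ x ∈ closedCell n c := by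
  simp only [largestSubgraph, mem_iUnion, exists_prop]

theorem largestSubgraph_subset (U : Set X) : largestSubgraph U ⊆ U := by
  intro x hx
  obtain ⟨n, c, h, hc⟩ := mem_largestSubgraph.1 hx
  exact h hc

theorem closedCell_subset_largestSubgraph {U : Set X} {n : ℕ} {c : cell (univ : Set X) n}
    (h : closedCell n c ⊆ U) : closedCell n c ⊆ largestSubgraph U :=
  fun _ hx => mem_largestSubgraph.2 ⟨n, c, h, hx⟩

theorem isCompact_iUnion_closedCell {S : Set (Σ n, cell (univ : Set X) n)} (hS : S.Finite) :
    IsCompact (⋃ c ∈ S, closedCell (C := (univ : Set X)) c.1 c.2) :=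
  hS.isCompact_biUnion fun _ _ => RelCWComplex.isCompact_closedCell

theorem exists_mem_closedCell (x : X) : ∃ c : Σ n, cell (univ : Set X) n,
    x ∈ openCell c.1 c.2 ∧ x ∈ closedCell c.1 c.2 := by
  obtain ⟨n, c, hc⟩ := exists_mem_openCell x
  exact ⟨⟨n, c⟩, hc, RelCWComplex.openCell_subset_closedCell _ _ hc⟩

variable [IsTopGraph X]

/-- This is where dimension at most one enters: a boundary point of an edge is a vertex, and a
vertex is a whole cell. -/
theorem closedCell_subset_closedCell {n m : ℕ} {c : cell (univ : Set X) n}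
    {d : cell (univ : Set X) m} {x : X} (hx : x ∈ openCell n c) (hx' : x ∈ closedCell m d) :
    closedCell n c ⊆ closedCell m d := by
  by_cases hd : x ∈ openCell m d
  · have h : (⟨n, c⟩ : Σ n, cell (univ : Set X) n) = ⟨m, d⟩ :=
      CWComplex.eq_of_not_disjoint_openCell (not_disjoint_iff.2 ⟨x, hx, hd⟩)
    cases h
    rfl
  · have hf : x ∈ cellFrontier m d := by
      rw [← RelCWComplex.cellFrontier_union_openCell_eq_closedCell] at hx'
      exact hx'.resolve_right hd
    have hv : x ∈ graphVertices X := by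
      revert hf
      refine IsTopGraph.cell_cases (P := fun m d => x ∈ cellFrontier m d → _) (fun v h => ?_)
        (fun e h => cellFrontier_one_subset e h) m d
      rw [RelCWComplex.cellFrontier_zero_eq_empty] at h
      exact h.elim
    obtain ⟨v, hv⟩ := mem_iUnion.1 hv
    have h : (⟨n, c⟩ : Σ n, cell (univ : Set X) n) = ⟨0, v⟩ :=
      CWComplex.eq_of_not_disjoint_openCell (not_disjoint_iff.2 ⟨x, hx, hv⟩)
    cases h
    rw [RelCWComplex.openCell_zero_eq_singleton, mem_singleton_iff] at hv
    rw [RelCWComplex.closedCell_zero_eq_singleton, ← hv]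
    exact singleton_subset_iff.2 hx'

theorem closedCell_subset_of_mem_largestSubgraph {U : Set X} {n : ℕ} {c : cell (univ : Set X) n}
    {x : X} (hx : x ∈ openCell n c) (hx' : x ∈ largestSubgraph U) :
    closedCell n c ⊆ largestSubgraph U := by
  obtain ⟨m, d, hd, hxd⟩ := mem_largestSubgraph.1 hx'
  exact (closedCell_subset_closedCell hx hxd).trans (closedCell_subset_largestSubgraph hd)

theorem isClosed_iUnion_closedCell (S : Set (Σ n, cell (univ : Set X) n)) :
    IsClosed (⋃ c ∈ S, closedCell (C := (univ : Set X)) c.1 c.2) := by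
  rw [biUnion_eq_iUnion]
  exact ((IsTopGraph.locallyFinite (X := X)).comp_injective Subtype.val_injective).isClosed_iUnion
    fun _ => RelCWComplex.isClosed_closedCell

theorem isClosed_largestSubgraph (U : Set X) : IsClosed (largestSubgraph U) := by
  convert isClosed_iUnion_closedCell
    {c : Σ n, cell (univ : Set X) n | closedCell c.1 c.2 ⊆ U} using 1
  ext x
  simp [mem_largestSubgraph, Sigma.exists]

theorem finite_setOf_closedCell_inter {K : Set X} (hK : IsCompact K) :
    {c : Σ n, cell (univ : Set X) n | (closedCell c.1 c.2 ∩ K).Nonempty}.Finite :=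
  (IsTopGraph.locallyFinite (X := X)).finite_nonempty_inter_compact hK

theorem exists_isCompact_compl_largestSubgraph {U C : Set X} (hC : IsCompact C) (h : Uᶜ ⊆ C) :
    ∃ D, IsCompact D ∧ (largestSubgraph U)ᶜ ⊆ D := by
  refine ⟨_, isCompact_iUnion_closedCell (finite_setOf_closedCell_inter hC), fun x hx => ?_⟩
  obtain ⟨c, -, hc⟩ := exists_mem_closedCell x
  refine mem_iUnion₂.2 ⟨c, ?_, hc⟩
  have hcU : ¬ closedCell c.1 c.2 ⊆ U := fun h' =>
    hx (closedCell_subset_largestSubgraph h' hc)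
  obtain ⟨y, hy, hyU⟩ := not_subset.1 hcU
  exact ⟨y, hy, h hyU⟩

instance IsTopGraph.instWeaklyLocallyCompactSpace : WeaklyLocallyCompactSpace X where
  exists_compact_mem_nhds x := by
    obtain ⟨O, hO, hf⟩ := IsTopGraph.locallyFinite (X := X) x
    refine ⟨_, isCompact_iUnion_closedCell hf, Filter.mem_of_superset hO fun y hy => ?_⟩
    obtain ⟨c, -, hc⟩ := exists_mem_closedCell y
    exact mem_iUnion₂.2 ⟨c, ⟨y, hc, hy⟩, hc⟩

variable (X) in
-- Iterated closed stars of a point are finite unions of closed cells. Their union and its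
-- complement are both unions of closed cells, hence closed by local finiteness, so connectedness
-- makes the union everything.
theorem IsTopGraph.sigmaCompactSpace [ConnectedSpace X] : SigmaCompactSpace X := by
  let x₀ : X := Classical.arbitrary X
  let star : Set X → Set X := fun K =>
    ⋃ c ∈ {c : Σ n, cell (univ : Set X) n | (closedCell c.1 c.2 ∩ K).Nonempty},
      closedCell (C := (univ : Set X)) c.1 c.2
  let K : ℕ → Set X := fun n => star^[n] {x₀}
  have hK : ∀ n, IsCompact (K n) := by
    intro n
    induction n with
    | zero => exact isCompact_singleton
    | succ n ih =>
      simp only [K, Function.iterate_succ_apply']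
      exact isCompact_iUnion_closedCell (finite_setOf_closedCell_inter ih)
  have hstar : ∀ n, ∀ c : Σ n, cell (univ : Set X) n, (closedCell c.1 c.2 ∩ K n).Nonempty →
      closedCell c.1 c.2 ⊆ K (n + 1) := by
    intro n c hc
    simp only [K, Function.iterate_succ_apply']
    exact subset_biUnion_of_mem (u := fun c : Σ n, cell (univ : Set X) n =>
      closedCell (C := (univ : Set X)) c.1 c.2) hc
  have hmem : ∀ n, K n ⊆ K (n + 1) := by
    intro n x hx
    obtain ⟨c, -, hc⟩ := exists_mem_closedCell x
    exact hstar n c ⟨x, hc, hx⟩ hc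
  have hcell : ∀ c : Σ n, cell (univ : Set X) n, (closedCell c.1 c.2 ∩ ⋃ n, K n).Nonempty →
      closedCell c.1 c.2 ⊆ ⋃ n, K n := by
    rintro c ⟨x, hx, hx'⟩
    obtain ⟨n, hn⟩ := mem_iUnion.1 hx'
    exact (hstar n c ⟨x, hx, hn⟩).trans (subset_iUnion K (n + 1))
  have e1 : (⋃ n, K n) = ⋃ c ∈ {c : Σ n, cell (univ : Set X) n | closedCell c.1 c.2 ⊆ ⋃ n, K n},
      closedCell (C := (univ : Set X)) c.1 c.2 := by
    apply Subset.antisymm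
    · intro x hx
      obtain ⟨c, -, hc⟩ := exists_mem_closedCell x
      exact mem_iUnion₂.2 ⟨c, hcell c ⟨x, hc, hx⟩, hc⟩
    · exact iUnion₂_subset fun c hc => hc
  have e2 : (⋃ n, K n)ᶜ = ⋃ c ∈ {c : Σ n, cell (univ : Set X) n |
      closedCell c.1 c.2 ⊆ (⋃ n, K n)ᶜ}, closedCell (C := (univ : Set X)) c.1 c.2 := by
    apply Subset.antisymm
    · intro x hx
      obtain ⟨c, -, hc⟩ := exists_mem_closedCell x
      refine mem_iUnion₂.2 ⟨c, fun y hy hy' => hx (hcell c ⟨y, hy, hy'⟩ hc), hc⟩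
    · exact iUnion₂_subset fun c hc => hc
  have hclopen : IsClopen (⋃ n, K n) := by
    refine ⟨e1 ▸ isClosed_iUnion_closedCell _, ?_⟩
    rw [← isClosed_compl_iff, e2]
    exact isClosed_iUnion_closedCell _
  refine ⟨⟨K, hK, hclopen.eq_univ ⟨x₀, mem_iUnion.2 ⟨0, ?_⟩⟩⟩⟩
  exact mem_singleton x₀

/-- Outside `D` a point mapped into `K` already lies in `K`, so the preimage of `K` sits inside the
product of `Y` with `K ∪ D`. Applied with `Y = I`, this makes homotopies proper. -/
theorem isProperMap_of_stationary {Y : Type*} [TopologicalSpace Y] [CompactSpace Y]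
    {D : Set X} (hD : IsCompact D) (F : C(Y × X, X)) (h : ∀ s, ∀ x ∉ D, F (s, x) = x) :
    IsProperMap F := by
  rw [isProperMap_iff_isCompact_preimage]
  refine ⟨F.continuous, fun K hK => ?_⟩
  refine (isCompact_univ.prod (hK.union hD)).of_isClosed_subset
    (hK.isClosed.preimage F.continuous) ?_
  rintro ⟨s, x⟩ hx
  refine ⟨mem_univ s, ?_⟩
  by_cases hxD : x ∈ D
  · exact .inr hxD
  · left
    simpa only [mem_preimage, h s x hxD] using hx

end Subgraphs

/-! ## Ends -/

section EndBases

variable {X : Type u} [TopologicalSpace X]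

theorem IsEndBasis.nonempty {U : ℕ → Set X} (hU : IsEndBasis X U) (n : ℕ) : (U n).Nonempty := by
  obtain ⟨-, K, -, -, -, h⟩ := hU
  obtain ⟨x, hx, h⟩ := h n
  rw [h]
  exact ⟨x, mem_connectedComponentIn hx⟩

theorem IsEndBasis.disjoint {U : ℕ → Set X} (hU : IsEndBasis X U) {C : Set X} (hC : IsCompact C) :
    ∃ n, ∀ m ≥ n, Disjoint (U m) C := by
  obtain ⟨-, K, hKm, -, hKe, h⟩ := hU
  obtain ⟨n, hn⟩ := hKe C hC
  refine ⟨n, fun m hm => ?_⟩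
  obtain ⟨x, -, h⟩ := h m
  rw [h]
  refine disjoint_left.2 fun y hy hyC => ?_
  exact connectedComponentIn_subset _ _ hy (hKm hm (hn hyC))

theorem IsEndBasis.isOpen [T2Space X] [LocallyConnectedSpace X] {U : ℕ → Set X}
    (hU : IsEndBasis X U) (n : ℕ) : IsOpen (U n) := by
  obtain ⟨-, K, -, hK, -, h⟩ := hU
  obtain ⟨x, -, h⟩ := h n
  rw [h]
  exact (hK n).isClosed.isOpen_compl.connectedComponentIn

/-- A connected set that meets `U n` and avoids a certain compact set is contained in `U n`. -/
theorem IsEndBasis.exists_isCompact_subset {U : ℕ → Set X} (hU : IsEndBasis X U) (n : ℕ) :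
    ∃ K, IsCompact K ∧ ∀ S, IsPreconnected S → (S ∩ U n).Nonempty → Disjoint S K → S ⊆ U n := by
  obtain ⟨-, K, -, hK, -, h⟩ := hU
  obtain ⟨x, -, h⟩ := h n
  refine ⟨K n, hK n, fun S hS hne hd => ?_⟩
  obtain ⟨y, hyS, hyU⟩ := hne
  rw [h] at hyU ⊢
  rw [connectedComponentIn_eq hyU]
  exact hS.subset_connectedComponentIn hyS hd.subset_compl_right

theorem IsEndBasis.shift {U : ℕ → Set X} (hU : IsEndBasis X U) (k : ℕ) :
    IsEndBasis X fun n => U (n + k) := by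
  obtain ⟨hA, K, hKm, hK, hKe, h⟩ := hU
  refine ⟨fun m n hmn => hA (by omega), fun n => K (n + k), fun m n hmn => hKm (by omega),
    fun n => hK _, fun C hC => ?_, fun n => h _⟩
  obtain ⟨n, hn⟩ := hKe C hC
  exact ⟨n, hn.trans (hKm (by omega))⟩

theorem IsBasisOfEnd.shift {U : ℕ → Set X} {E : GraphEnd X} (hU : IsBasisOfEnd U E) (k : ℕ) :
    IsBasisOfEnd (fun n => U (n + k)) E := by
  obtain ⟨h, rfl⟩ := hU
  exact ⟨h.shift k, Quotient.sound fun n => ⟨⟨n, h.1 (by omega)⟩, n + k, subset_rfl⟩⟩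

theorem IsBasisOfEnd.exists_subset {U V : ℕ → Set X} {E : GraphEnd X} (hU : IsBasisOfEnd U E)
    (hV : IsBasisOfEnd V E) (n : ℕ) : ∃ i, ∀ j ≥ i, U j ⊆ V n := by
  obtain ⟨h, rfl⟩ := hU
  obtain ⟨h', e⟩ := hV
  obtain ⟨i, hi⟩ := (Quotient.exact e n).2
  exact ⟨i, fun j hj => (h.1 hj).trans hi⟩

/-- Terms of a neighborhood basis that are small enough are neighborhoods. -/
theorem IsEndNhd.of_basis [T2Space X] [LocallyConnectedSpace X] {U : ℕ → Set X} {E : GraphEnd X}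
    {N : Set X} (hN : IsEndNhd N E) (hU : IsBasisOfEnd U E) {n : ℕ} (h : U n ⊆ N) :
    IsEndNhd (U n) E := by
  refine ⟨hU.1.isOpen n, fun B hB => hB.exists_subset hU n, fun F hF B hB => ?_⟩
  exact (hN.2.2 F hF B hB).subset fun m hm => hm.mono (inter_subset_inter_left _ h)

/-- The inductive step in the proof of `exists_basis_inter_nonempty`. -/
theorem exists_connectedComponentIn_unbounded [T2Space X] [LocallyConnectedSpace X]
    [PreconnectedSpace X] {L M A V : Set X} (hL : IsCompact L) (hM : IsCompact M)
    (hLM : L ⊆ interior M) (hV : ∀ S, IsPreconnected S → (S ∩ V).Nonempty → S ⊆ Lᶜ → S ⊆ V)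
    (hA : ∀ C, IsCompact C → ¬ V ∩ A ⊆ C) :
    ∃ x ∈ Lᶜ, connectedComponentIn Lᶜ x ⊆ V ∧
      ∀ C, IsCompact C → ¬ connectedComponentIn Lᶜ x ∩ A ⊆ C := by
  by_contra! hcon
  have hO : IsOpen Lᶜ := hL.isClosed.isOpen_compl
  have hcomp : ∀ x ∈ V, x ∉ L → connectedComponentIn Lᶜ x ⊆ V := fun x hx hxL =>
    hV _ isPreconnected_connectedComponentIn ⟨x, mem_connectedComponentIn hxL, hx⟩
      (connectedComponentIn_subset _ _)
  -- The components of `Lᶜ` are open, so finitely many of them cover the compact set `frontier M`.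
  -- If each meets `V ∩ A` in a relatively compact set, then `V ∩ A` is relatively compact, because
  -- every component reaching outside `M` crosses `frontier M`.
  have hF : IsCompact (frontier M) :=
    hM.of_isClosed_subset isClosed_frontier hM.isClosed.frontier_subset
  have hFL : frontier M ⊆ Lᶜ := fun x hx hxL => hx.2 (hLM hxL)
  have hC : ∀ x ∈ frontier M, ∃ C, IsCompact C ∧ connectedComponentIn Lᶜ x ∩ (V ∩ A) ⊆ C := by
    intro x hx
    by_cases h : (connectedComponentIn Lᶜ x ∩ V).Nonempty
    · obtain ⟨C, hC, h⟩ := hcon x (hFL hx)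
        (hV _ isPreconnected_connectedComponentIn h (connectedComponentIn_subset _ _))
      exact ⟨C, hC, (inter_subset_inter_right _ inter_subset_right).trans h⟩
    · refine ⟨∅, isCompact_empty, fun y hy => h ⟨y, hy.1, hy.2.1⟩⟩
  choose! C hC hCs using hC
  obtain ⟨t, htF, ht⟩ := hF.elim_nhds_subcover (fun x => connectedComponentIn Lᶜ x)
    fun x hx => (hO.connectedComponentIn).mem_nhds (mem_connectedComponentIn (hFL hx))
  -- A component equal to the whole space need not cross `frontier M`; then `A` itself would be
  -- relatively compact.
  by_cases huniv : ∃ x ∈ V, x ∉ L ∧ connectedComponentIn Lᶜ x = univ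
  · obtain ⟨x, hxV, hxL, hx⟩ := huniv
    obtain ⟨C, hC, h⟩ := hcon x hxL (hcomp x hxV hxL)
    rw [hx, univ_inter] at h
    exact hA C hC (inter_subset_right.trans h)
  · push Not at huniv
    refine hA (M ∪ ⋃ x ∈ t, C x)
      (hM.union (t.isCompact_biUnion fun x hx => hC x (htF x hx))) ?_
    rintro y ⟨hyV, hyA⟩
    by_cases hyM : y ∈ M
    · exact .inl hyM
    right
    have hyL : y ∉ L := fun h => hyM (interior_subset (hLM h))
    set V' := connectedComponentIn Lᶜ y with hV'
    have hyV' : y ∈ V' := mem_connectedComponentIn hyL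
    -- A component that misses `frontier M` and contains a point off `M` stays off `interior M`. Its
    -- closure then avoids `L`, so it is clopen and equals the whole space.
    have hne : (V' ∩ frontier M).Nonempty := by
      by_contra hne
      rw [not_nonempty_iff_eq_empty] at hne
      have hsub : V' ⊆ (interior M)ᶜ := by
        have hcov : V' ⊆ interior M ∪ Mᶜ := by
          intro z hz
          by_cases hzM : z ∈ M
          · left
            by_contra hzi
            exact hne.subset ⟨hz, subset_closure hzM, hzi⟩
          · exact .inr hzM
        rcases isPreconnected_connectedComponentIn.subset_or_subset isOpen_interior
          hM.isClosed.isOpen_compl (disjoint_compl_right.mono_left interior_subset) hcov with h | h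
        · exact absurd (interior_subset (h hyV')) hyM
        · exact h.trans (compl_subset_compl.2 interior_subset)
      have hcl : closure V' ⊆ Lᶜ :=
        (closure_minimal hsub isOpen_interior.isClosed_compl).trans (compl_subset_compl.2 hLM)
      have hclosed : IsClosed V' := by
        refine closure_subset_iff_isClosed.1 ?_
        exact isPreconnected_connectedComponentIn.closure.subset_connectedComponentIn
          (subset_closure hyV') hcl
      exact huniv y hyV hyL
        (IsClopen.eq_univ ⟨hclosed, hO.connectedComponentIn⟩ ⟨y, hyV'⟩)
    obtain ⟨z, hzV', hzF⟩ := hne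
    obtain ⟨x, hxt, hx⟩ := mem_iUnion₂.1 (ht hzF)
    refine mem_iUnion₂.2 ⟨x, hxt, hCs x (htF x hxt) ⟨?_, hyV, hyA⟩⟩
    rw [connectedComponentIn_eq hx, ← connectedComponentIn_eq hzV']
    exact hyV'

/-- A set that is not relatively compact accumulates at an end. -/
theorem exists_basis_inter_nonempty [T2Space X] [LocallyConnectedSpace X] [ConnectedSpace X]
    [WeaklyLocallyCompactSpace X] [SigmaCompactSpace X] {A : Set X}
    (hA : ∀ C, IsCompact C → ¬ A ⊆ C) : ∃ U E, IsBasisOfEnd U E ∧ ∀ n, (U n ∩ A).Nonempty := by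
  -- The shift puts `∅` at index `0`, so the recursion starts with the component `X`; each later
  -- component is chosen inside the previous one, with unbounded trace of `A`.
  let K : CompactExhaustion X := (CompactExhaustion.choice X).shiftr
  let P : ℕ → X → Prop := fun n x => x ∉ K n ∧
    ∀ C, IsCompact C → ¬ connectedComponentIn (K n)ᶜ x ∩ A ⊆ C
  have step : ∀ n (x : {x // P n x}), ∃ y : {y // P (n + 1) y},
      connectedComponentIn (K (n + 1))ᶜ y.1 ⊆ connectedComponentIn (K n)ᶜ x.1 := by
    rintro n ⟨x, hx⟩
    obtain ⟨y, hy, hyV, hyA⟩ := exists_connectedComponentIn_unbounded (A := A)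
      (V := connectedComponentIn (K n)ᶜ x) (K.isCompact (n + 1)) (K.isCompact (n + 2))
      (K.subset_interior_succ (n + 1)) (fun S hS hSV hSK => by
        obtain ⟨z, hz, hzV⟩ := hSV
        rw [connectedComponentIn_eq hzV]
        exact hS.subset_connectedComponentIn hz
          (hSK.trans (compl_subset_compl.2 (K.subset_succ n)))) hx.2
    exact ⟨⟨y, hy, hyA⟩, hyV⟩
  choose f hf using step
  have h0 : P 0 (Classical.arbitrary X) := by
    have : K 0 = ∅ := rfl
    simp only [P, this, notMem_empty, not_false_eq_true, compl_empty, connectedComponentIn_univ,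
      PreconnectedSpace.connectedComponent_eq_univ, univ_inter, true_and]
    exact hA
  let x : ∀ n, {x // P n x} := fun n => Nat.rec ⟨_, h0⟩ f n
  let U : ℕ → Set X := fun n => connectedComponentIn (K n)ᶜ (x n).1
  have hU : IsEndBasis X U := by
    refine ⟨antitone_nat_of_succ_le fun n => hf n (x n), K, fun m n h => K.subset h, K.isCompact,
      fun C hC => ?_, fun n => ⟨_, (x n).2.1, rfl⟩⟩
    exact K.exists_superset_of_isCompact hC
  refine ⟨U, _, ⟨hU, rfl⟩, fun n => ?_⟩
  by_contra h
  rw [not_nonempty_iff_eq_empty] at h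
  exact (x n).2.2 ∅ isCompact_empty h.subset

/-- The complement of a union of neighborhoods of all ends is relatively compact. -/
theorem exists_isCompact_compl_iUnion [T2Space X] [LocallyConnectedSpace X] [ConnectedSpace X]
    [WeaklyLocallyCompactSpace X] [SigmaCompactSpace X] {N : Set X}
    (hN : ∀ E U, IsBasisOfEnd U E → ∃ n, U n ⊆ N) : ∃ C, IsCompact C ∧ Nᶜ ⊆ C := by
  by_contra! h
  obtain ⟨U, E, hU, hne⟩ := exists_basis_inter_nonempty (A := Nᶜ) h
  obtain ⟨n, hn⟩ := hN E U hU
  obtain ⟨x, hx, hx'⟩ := hne n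
  exact hx' (hn hx)

/-- The difference of two neighborhoods of an end is relatively compact. -/
theorem IsEndNhd.exists_isCompact_sdiff [T2Space X] [LocallyConnectedSpace X] [ConnectedSpace X]
    [WeaklyLocallyCompactSpace X] [SigmaCompactSpace X] {N : Set X} {E : GraphEnd X}
    (hN : IsEndNhd N E) {B : ℕ → Set X} (hB : IsBasisOfEnd B E) (k : ℕ) :
    ∃ C, IsCompact C ∧ N \ B k ⊆ C := by
  by_contra! h
  obtain ⟨U, F, hU, hne⟩ := exists_basis_inter_nonempty h
  -- The difference cannot accumulate at `E`, where small terms lie in `B k`, nor at another end,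
  -- whose basis terms meet `N` only finitely often.
  by_cases hF : F = E
  · subst hF
    obtain ⟨n, hn⟩ := hU.exists_subset hB k
    obtain ⟨x, hx, hx'⟩ := hne n
    exact hx'.2 (hn n le_rfl hx)
  · refine infinite_univ ((hN.2.2 F hF U hU).subset fun n _ => ?_)
    obtain ⟨x, hx, hx'⟩ := hne n
    exact ⟨x, hx'.1, hx⟩

end EndBases

/-! ## End-periodic maps are proper and invertible near infinity -/

section EndPeriodic

variable {X : Type u} [TopologicalSpace X] [CWComplex (univ : Set X)]

theorem isPreconnected_openCell (n : ℕ) (c : cell (univ : Set X) n) :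
    IsPreconnected (openCell n c) :=
  (convex_ball (0 : Fin n → ℝ) 1).isPreconnected.image _
    ((continuousOn n c).mono Metric.ball_subset_closedBall)

/-- `f` maps the open cells contained in `S` onto open cells of the same dimension. -/
def MapsCellsOn (f : X → X) (S : Set X) : Prop :=
  ∀ n (c : cell (univ : Set X) n), openCell n c ⊆ S →
    ∃ c' : cell (univ : Set X) n, f '' openCell n c = openCell n c'

/-- Injectivity on points becomes injectivity on cells, which allows counting. Outside the cells
contained in `S` the value of `φ` is a dummy. -/
theorem MapsCellsOn.exists_injOn {f : X → X} {S : Set X} (hf : MapsCellsOn f S)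
    (hinj : InjOn f S) : ∃ φ : (Σ n, cell (univ : Set X) n) → Σ n, cell (univ : Set X) n,
      (∀ c, openCell c.1 c.2 ⊆ S → f '' openCell c.1 c.2 = openCell (φ c).1 (φ c).2) ∧
      InjOn φ {c | openCell c.1 c.2 ⊆ S} := by
  have h : ∀ c : Σ n, cell (univ : Set X) n, ∃ c' : Σ n, cell (univ : Set X) n,
      openCell c.1 c.2 ⊆ S → f '' openCell c.1 c.2 = openCell c'.1 c'.2 := by
    rintro ⟨n, c⟩
    by_cases hc : openCell n c ⊆ S
    · obtain ⟨c', hc'⟩ := hf n c hc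
      exact ⟨⟨n, c'⟩, fun _ => hc'⟩
    · exact ⟨⟨n, c⟩, fun h => absurd h hc⟩
  choose φ hφ using h
  refine ⟨φ, hφ, fun c hc d hd hcd => ?_⟩
  obtain ⟨x, hx⟩ := RelCWComplex.openCell_nonempty c.1 c.2
  have h1 : f x ∈ f '' openCell d.1 d.2 := by
    rw [hφ d hd, ← hcd, ← hφ c hc]
    exact mem_image_of_mem f hx
  obtain ⟨y, hy, hyx⟩ := h1
  obtain rfl : y = x := hinj (hd hy) (hc hx) hyx
  exact CWComplex.eq_of_not_disjoint_openCell (not_disjoint_iff.2 ⟨y, hx, hy⟩)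

theorem MapsCellsOn.iterate {f : X → X} {S L : Set X} (hf : MapsCellsOn f L)
    (hinj : InjOn f L) {p : ℕ} (h : ∀ i < p, MapsTo f^[i] S L) :
    MapsCellsOn f^[p] S ∧ InjOn f^[p] S := by
  induction p with
  | zero => exact ⟨fun n c _ => ⟨c, by simp⟩, injOn_id S⟩
  | succ p ih =>
    obtain ⟨ih1, ih2⟩ := ih fun i hi => h i (by omega)
    rw [Function.iterate_succ']
    refine ⟨fun n c hc => ?_, hinj.comp ih2 (h p (by omega))⟩
    obtain ⟨c', hc'⟩ := ih1 n c hc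
    rw [image_comp, hc']
    refine hf n c' ?_
    rw [← hc']
    exact (image_mono hc).trans (h p (by omega)).image_subset

theorem IsGraphMap.mapsCellsOn [IsTopGraph X] {g : C(X, X)} (hg : IsGraphMap g) {S : Set X}
    (hedge : ∀ e : cell (univ : Set X) 1, openCell 1 e ⊆ S →
      ∃ e' : cell (univ : Set X) 1, g '' openCell 1 e = openCell 1 e') : MapsCellsOn g S := by
  refine IsTopGraph.cell_cases (P := fun n c => openCell n c ⊆ S →
    ∃ c' : cell (univ : Set X) n, g '' openCell n c = openCell n c') (fun v _ => ?_) hedge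
  obtain ⟨w, hw⟩ := mem_graphVertices_iff.1 (hg.1 (mem_iUnion.2 ⟨v,
    RelCWComplex.map_zero_mem_openCell 0 v⟩))
  refine ⟨w, ?_⟩
  rw [hw, RelCWComplex.openCell_zero_eq_singleton, image_singleton]
  congr
  exact Subsingleton.elim _ _

variable [IsTopGraph X]

/-- Distinct cells of `L` have distinct image cells, and only finitely many cells meet `K`; so
finitely many cells of `L` meet the preimage of `K`, and the rest of it lies in `D`. -/
theorem isProperMap_of_injOn {g : C(X, X)} {L D : Set X} (hcell : MapsCellsOn g L)
    (hinj : InjOn g L) (hL : ∀ c : Σ n, cell (univ : Set X) n, ∀ x ∈ openCell c.1 c.2, x ∈ L →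
      openCell c.1 c.2 ⊆ L) (hD : IsCompact D) (hLD : Lᶜ ⊆ D) : IsProperMap g := by
  rw [isProperMap_iff_isCompact_preimage]
  refine ⟨g.continuous, fun K hK => ?_⟩
  obtain ⟨φ, hφ, hφi⟩ := hcell.exists_injOn hinj
  have hfin : {c : Σ n, cell (univ : Set X) n |
      openCell c.1 c.2 ⊆ L ∧ (openCell c.1 c.2 ∩ g ⁻¹' K).Nonempty}.Finite := by
    refine Finite.of_finite_image ((finite_setOf_closedCell_inter hK).subset ?_)
      (f := φ) (hφi.mono fun c hc => hc.1)
    rintro _ ⟨c, ⟨hc, x, hx, hxK⟩, rfl⟩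
    refine ⟨g x, RelCWComplex.openCell_subset_closedCell _ _ ?_, hxK⟩
    rw [← hφ c hc]
    exact mem_image_of_mem g hx
  refine (hD.union (isCompact_iUnion_closedCell hfin)).of_isClosed_subset
    (hK.isClosed.preimage g.continuous) fun x hx => ?_
  by_cases hxL : x ∈ L
  · obtain ⟨c, hc, hc'⟩ := exists_mem_closedCell x
    exact .inr (mem_iUnion₂.2 ⟨c, ⟨hL c x hc hxL, x, hc, hx⟩, hc'⟩)
  · exact .inl (hLD hxL)

/-- A map that shifts a neighborhood basis of an end outwards is surjective near this end. -/
theorem exists_subset_range_of_preimage {f : X → X} {W : ℕ → Set X} (hW : IsEndBasis X W)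
    (hpre : ∀ n, f ⁻¹' W n = W (n + 1)) {n₀ : ℕ} (hcell : MapsCellsOn f (W n₀))
    (hinj : InjOn f (W n₀)) (hdiff : ∀ k, ∃ C, IsCompact C ∧ W 0 \ W k ⊆ C) :
    ∃ n, W n ⊆ range f := by
  -- The layers: cells contained in `W n` but not in `W (n + 1)`. Each is finite because it consists
  -- of cells meeting a compact set.
  let T : ℕ → Set (Σ n, cell (univ : Set X) n) := fun n =>
    {c | openCell c.1 c.2 ⊆ W n ∧ ¬ openCell c.1 c.2 ⊆ W (n + 1)}
  have hT : ∀ n, (T n).Finite := by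
    intro n
    obtain ⟨C, hC, h⟩ := hdiff (n + 1)
    refine (finite_setOf_closedCell_inter hC).subset ?_
    rintro c ⟨hc, hc'⟩
    obtain ⟨x, hx, hxW⟩ := not_subset.1 hc'
    exact ⟨x, RelCWComplex.openCell_subset_closedCell _ _ hx,
      h ⟨hW.1 (Nat.zero_le n) (hc hx), hxW⟩⟩
  obtain ⟨φ, hφ, hφi⟩ := hcell.exists_injOn hinj
  -- Since `f ⁻¹' W n = W (n + 1)`, the map on cells lowers the layer by exactly one.
  have hmaps : ∀ n ≥ n₀, φ '' T (n + 1) ⊆ T n := by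
    rintro n hn _ ⟨c, hc, rfl⟩
    have hc0 : openCell c.1 c.2 ⊆ W n₀ := hc.1.trans (hW.1 (by omega))
    constructor
    · rw [← hφ c hc0, image_subset_iff, hpre]
      exact hc.1
    · rw [← hφ c hc0, image_subset_iff, hpre]
      exact hc.2
  have hinjT : ∀ n ≥ n₀, InjOn φ (T (n + 1)) := fun n hn =>
    hφi.mono fun c hc => hc.1.trans (hW.1 (by omega))
  have hcard : ∀ n ≥ n₀, (T (n + 1)).ncard ≤ (T n).ncard := fun n hn => by
    rw [← (hinjT n hn).ncard_image]
    exact ncard_le_ncard (hmaps n hn) (hT n)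
  -- From `n₀` on the sizes of the layers do not increase. Past an index of minimal size they are
  -- constant, so the injections between layers are onto.
  obtain ⟨n₁, hn₁, hmin⟩ := exists_minimalFor_of_wellFoundedLT (fun n => n₀ ≤ n)
    (fun n => (T n).ncard) ⟨n₀, le_rfl⟩
  have hconst : ∀ n ≥ n₁, (T n).ncard ≤ (T n₁).ncard := by
    intro n hn
    induction n, hn using Nat.le_induction with
    | base => rfl
    | succ n hn ih => exact (hcard n (hn₁.trans hn)).trans ih
  have hsurj : ∀ n ≥ n₁, φ '' T (n + 1) = T n := by
    intro n hn
    refine eq_of_subset_of_ncard_le (hmaps n (hn₁.trans hn)) ?_ (hT n)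
    rw [(hinjT n (hn₁.trans hn)).ncard_image]
    exact (hconst n hn).trans (hmin (hn₁.trans (hn.trans n.le_succ)) (hconst _ (by omega)))
  have hrange : ∀ c : Σ n, cell (univ : Set X) n, openCell c.1 c.2 ⊆ W n₁ →
      openCell c.1 c.2 ⊆ range f := by
    classical
    -- Every cell in `W n₁` belongs to some later layer, as the sets `W n` eventually leave each
    -- point.
    intro c hc
    have hex : ∃ k, ¬ openCell c.1 c.2 ⊆ W (n₁ + k) := by
      obtain ⟨x, hx⟩ := RelCWComplex.openCell_nonempty c.1 c.2
      obtain ⟨n, hn⟩ := hW.disjoint (isCompact_singleton (x := x))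
      exact ⟨n, fun h => (hn (n₁ + n) (by omega)).notMem_of_mem_left (h hx) rfl⟩
    obtain ⟨k, hk, hk'⟩ : ∃ k, openCell c.1 c.2 ⊆ W (n₁ + k) ∧
        ¬ openCell c.1 c.2 ⊆ W (n₁ + k + 1) := by
      by_contra! h
      obtain ⟨k, hk⟩ := hex
      refine hk ?_
      clear hk
      induction k with
      | zero => exact hc
      | succ k ih => exact h k ih
    have hcT : c ∈ T (n₁ + k) := ⟨hk, hk'⟩
    rw [← hsurj _ (by omega)] at hcT
    obtain ⟨d, hd, rfl⟩ := hcT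
    rw [← hφ d (hd.1.trans (hW.1 (by omega)))]
    exact image_subset_range _ _
  -- A point of `W n₁` may lie in a cell that sticks out of `W n₁`. Going further out, past all
  -- closed cells that meet `K`, the open cell of a point avoids `K` and, being connected, stays in
  -- `W n₁`.
  obtain ⟨K, hK, hKW⟩ := hW.exists_isCompact_subset n₁
  obtain ⟨m, hm⟩ := hW.disjoint
    (isCompact_iUnion_closedCell (finite_setOf_closedCell_inter hK))
  refine ⟨max m n₁, fun x hx => ?_⟩
  obtain ⟨c, hc, hc'⟩ := exists_mem_closedCell x
  refine hrange c (hKW _ (isPreconnected_openCell _ _)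
    ⟨x, hc, hW.1 (le_max_right _ _) hx⟩ ?_) hc
  rw [disjoint_left]
  intro y hy hyK
  exact (hm _ (le_max_left _ _)).notMem_of_mem_left hx
    (mem_iUnion₂.2 ⟨c, ⟨y, RelCWComplex.openCell_subset_closedCell _ _ hy, hyK⟩, hc'⟩)

theorem IsProperMap.iterate {Y : Type*} [TopologicalSpace Y] {f : Y → Y} (hf : IsProperMap f)
    (n : ℕ) : IsProperMap f^[n] := by
  induction n with
  | zero => exact isProperMap_id
  | succ n ih =>
    rw [Function.iterate_succ]
    exact ih.comp hf

/-- Over the closed subgraph `Y`, the map `g` is bijective and maps cells to cells. -/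
structure IsInvertibleOver (g : C(X, X)) (Y : Set X) : Prop where
  isClosed : IsClosed Y
  closedCell_subset : ∀ e : cell (univ : Set X) 1, ∀ x ∈ openCell 1 e, x ∈ Y → closedCell 1 e ⊆ Y
  exists_eq : ∀ y ∈ Y, ∃ x, g x = y
  injective : ∀ x x', g x ∈ Y → g x = g x' → x = x'
  exists_edge : ∀ e : cell (univ : Set X) 1, closedCell 1 e ⊆ Y →
    ∃ e' : cell (univ : Set X) 1, g '' openCell 1 e' = openCell 1 e
  exists_vertex : ∀ v ∈ graphVertices X, v ∈ Y → ∃ w ∈ graphVertices X, g w = v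

/-- `Y` is the largest subgraph that avoids `g '' D` and `R`, where `D` contains the complement of
`L` and `R` contains the complement of the range. A point of `Y` then has a preimage, and all its
preimages lie in `L`, where `g` is injective and cellular. -/
theorem IsEndPeriodic.exists_isInvertibleOver [ConnectedSpace X] {g : C(X, X)}
    (hg : IsEndPeriodic g) : IsProperMap g ∧
      ∃ Y, IsInvertibleOver g Y ∧ ∃ C, IsCompact C ∧ Yᶜ ⊆ C := by
  obtain ⟨hgm, U, hU, hemb, hedge, p, hp, hdyn⟩ := hg
  have := IsTopGraph.sigmaCompactSpace X
  set L := largestSubgraph (⋃ E, U E) with hL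
  have hcell : MapsCellsOn g L := hgm.mapsCellsOn hedge
  have hinj : InjOn g L := by
    intro x hx y hy hxy
    exact congrArg Subtype.val (hemb.injective (a₁ := ⟨x, hx⟩) (a₂ := ⟨y, hy⟩) hxy)
  obtain ⟨C, hC, hUC⟩ := exists_isCompact_compl_iUnion (N := ⋃ E, U E) fun E B hB => by
    obtain ⟨N, hN⟩ := (hU E).2.1 B hB
    exact ⟨N, (hN N le_rfl).trans (subset_iUnion U E)⟩
  obtain ⟨D, hD, hLD⟩ := exists_isCompact_compl_largestSubgraph hC hUC
  have hproper : IsProperMap g := isProperMap_of_injOn hcell hinj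
    (fun c x hx hxL => (RelCWComplex.openCell_subset_closedCell _ _).trans
      (closedCell_subset_of_mem_largestSubgraph hx hxL)) hD hLD
  refine ⟨hproper, ?_⟩
  have hpow : range g^[p] ⊆ range g := by
    obtain ⟨q, rfl⟩ := Nat.exists_eq_succ_of_ne_zero hp.ne'
    rw [Function.iterate_succ']
    exact range_comp_subset_range _ _
  obtain ⟨R, hR, hRg⟩ := exists_isCompact_compl_iUnion (N := range g) fun E B hB => by
    rcases hdyn E with ⟨-, hb⟩ | ⟨-, hb⟩
    · obtain ⟨i, hi⟩ := hB.exists_subset hb 1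
      refine ⟨i, (hi i le_rfl).trans ?_⟩
      rw [mul_one]
      exact (image_subset_range _ _).trans hpow
    -- Far enough out, the first `p` points of an orbit (times `0` to `p - 1`) stay in `L`, so
    -- `g^[p]` is injective and cellular there.
    · have hK : IsCompact (⋃ i ∈ Finset.range p, g^[i] ⁻¹' D) :=
        (Finset.range p).isCompact_biUnion fun i _ => (hproper.iterate i).isCompact_preimage hD
      obtain ⟨n₀, hn₀⟩ := hb.1.disjoint hK
      have hmaps : ∀ i < p, MapsTo g^[i] (g^[p * n₀] ⁻¹' U E) L := by
        intro i hi x hx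
        by_contra hxL
        exact (hn₀ n₀ le_rfl).notMem_of_mem_left hx
          (mem_iUnion₂.2 ⟨i, Finset.mem_range.2 hi, hLD hxL⟩)
      obtain ⟨h1, h2⟩ := hcell.iterate hinj hmaps
      obtain ⟨n, hn⟩ := exists_subset_range_of_preimage hb.1 (f := g^[p]) (n₀ := n₀)
        (fun n => by
          rw [← preimage_comp, ← Function.iterate_add, mul_add, mul_one]) h1 h2
        (fun k => by
          have := (hU E).exists_isCompact_sdiff hb k
          simpa only [mul_zero, Function.iterate_zero, preimage_id] using this)
      obtain ⟨i, hi⟩ := hB.exists_subset hb n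
      exact ⟨i, (hi i le_rfl).trans (hn.trans hpow)⟩
  have hBad : IsCompact (g '' D ∪ R) := (hD.image g.continuous).union hR
  have hYL : ∀ x, g x ∈ largestSubgraph (g '' D ∪ R)ᶜ → x ∈ L := by
    intro x hx
    by_contra hxL
    exact largestSubgraph_subset _ hx (.inl (mem_image_of_mem g (hLD hxL)))
  have hYr : ∀ y ∈ largestSubgraph (g '' D ∪ R)ᶜ, ∃ x, g x = y := by
    intro y hy
    by_contra hyr
    exact largestSubgraph_subset _ hy (.inr (hRg hyr))
  have hcells : ∀ n (c : cell (univ : Set X) n), ∀ x ∈ openCell n c,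
      x ∈ largestSubgraph (g '' D ∪ R)ᶜ →
        ∃ c' : cell (univ : Set X) n, g '' openCell n c' = openCell n c := by
    intro n c y hy hyY
    obtain ⟨x, rfl⟩ := hYr y hyY
    obtain ⟨m, d, hd⟩ := exists_mem_openCell x
    obtain ⟨d', hd'⟩ := hcell m d ((RelCWComplex.openCell_subset_closedCell _ _).trans
      (closedCell_subset_of_mem_largestSubgraph hd (hYL x hyY)))
    have h : (⟨m, d'⟩ : Σ n, cell (univ : Set X) n) = ⟨n, c⟩ :=
      CWComplex.eq_of_not_disjoint_openCell
        (not_disjoint_iff.2 ⟨g x, hd' ▸ mem_image_of_mem g hd, hy⟩)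
    cases h
    exact ⟨d, hd'⟩
  refine ⟨largestSubgraph (g '' D ∪ R)ᶜ, ⟨isClosed_largestSubgraph _, fun e x hx hxY =>
    closedCell_subset_of_mem_largestSubgraph hx hxY, hYr, fun x x' hx hxx' =>
    hinj (hYL x hx) (hYL x' (hxx' ▸ hx)) hxx', fun e he => ?_, fun v hv hvY => ?_⟩, ?_⟩
  · obtain ⟨x, hx⟩ := RelCWComplex.openCell_nonempty 1 e
    exact hcells 1 e x hx (he (RelCWComplex.openCell_subset_closedCell _ _ hx))
  · obtain ⟨c, hc⟩ := mem_graphVertices_iff.1 hv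
    obtain ⟨c', hc'⟩ := hcells 0 c v (hc ▸ mem_singleton v) hvY
    obtain ⟨w, hw, hwv⟩ : v ∈ g '' openCell 0 c' := by rw [hc', hc]; rfl
    exact ⟨w, mem_iUnion.2 ⟨c', hw⟩, hwv⟩
  · exact exists_isCompact_compl_largestSubgraph hBad (by rw [compl_compl])

end EndPeriodic

/-! ## Paths up to homotopy -/

section Paths

variable {X : Type u} [TopologicalSpace X]

namespace Path.Homotopic.Quotient

theorem symm_trans_cancel {x y z : X} (p : Path.Homotopic.Quotient x y)
    (q : Path.Homotopic.Quotient y z) : p.symm.trans (p.trans q) = q := by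
  rw [← trans_assoc, symm_trans, refl_trans]

theorem trans_symm_cancel {x y z : X} (p : Path.Homotopic.Quotient y x)
    (q : Path.Homotopic.Quotient y z) : p.trans (p.symm.trans q) = q := by
  rw [← trans_assoc, trans_symm, refl_trans]

theorem symm_of_trans {x y z : X} (p : Path.Homotopic.Quotient x y)
    (q : Path.Homotopic.Quotient y z) : (p.trans q).symm = q.symm.trans p.symm := by
  induction p using Path.Homotopic.Quotient.ind with | mk p =>
  induction q using Path.Homotopic.Quotient.ind with | mk q =>
  rw [← mk_trans, ← mk_symm, Path.trans_symm, mk_trans, mk_symm, mk_symm]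

theorem symm_refl (x : X) : (refl x).symm = refl x := by
  rw [← mk_refl, ← mk_symm, Path.refl_symm]

theorem map_trans {Y : Type*} [TopologicalSpace Y] {x y z : X} (p : Path.Homotopic.Quotient x y)
    (q : Path.Homotopic.Quotient y z) (f : C(X, Y)) :
    (p.trans q).map f = (p.map f).trans (q.map f) := by
  induction p using Path.Homotopic.Quotient.ind with | mk p =>
  induction q using Path.Homotopic.Quotient.ind with | mk q =>
  rw [← mk_trans, ← mk_map, Path.map_trans, mk_trans, mk_map, mk_map]

theorem map_symm {Y : Type*} [TopologicalSpace Y] {x y : X} (p : Path.Homotopic.Quotient x y)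
    (f : C(X, Y)) : p.symm.map f = (p.map f).symm := by
  induction p using Path.Homotopic.Quotient.ind with | mk p =>
  rw [← mk_symm, ← mk_map, ← Path.map_symm, mk_symm, mk_map]

end Path.Homotopic.Quotient

/-- The naturality of a homotopy along a path. -/
theorem ContinuousMap.Homotopy.mk_map_trans_evalAt {Y : Type*} [TopologicalSpace Y] {f g : C(X, Y)}
    (F : f.Homotopy g) {x y : X} (p : Path.Homotopic.Quotient x y) :
    (p.map f).trans (.mk (F.evalAt y)) =
      (Path.Homotopic.Quotient.mk (F.evalAt x)).trans (p.map g) := by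
  induction p using Path.Homotopic.Quotient.ind with | mk p =>
  exact Path.Homotopic.Quotient.eq.2 (Path.Homotopic.map_trans_evalAt F p)

/-- A homotopy equivalence is fully faithful on fundamental groupoids. -/
theorem IsHomotopyEquivalence.bijective_map {g : C(X, X)} (hg : IsHomotopyEquivalence g) (x y : X) :
    Function.Bijective fun q : Path.Homotopic.Quotient x y => q.map g := by
  obtain ⟨g', h1, h2⟩ := hg
  let E : ContinuousMap.HomotopyEquiv X X := ⟨g, g', h1, h2⟩
  let F := FundamentalGroupoidFunctor.equivOfHomotopyEquiv E
  exact F.fullyFaithfulFunctor.map_bijective (X := ⟨x⟩) (Y := ⟨y⟩)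

/-- A consequence of the tube lemma: no continuity of `S` is needed, because `K` is constant on the
compact slice over `z`. It handles the two corners in `exists_square`. -/
theorem tendsto_of_forall_eq {Y Z : Type*} [TopologicalSpace Y] [TopologicalSpace Z]
    [CompactSpace Y] {K : Y × Z → X} (hK : Continuous K) {z : Z} {x : X} (h : ∀ y, K (y, z) = x)
    {W : Type*} {l : Filter W} (S : W → Y) {T : W → Z} (hT : Filter.Tendsto T l (𝓝 z)) :
    Filter.Tendsto (fun w => K (S w, T w)) l (𝓝 x) := by
  rw [tendsto_nhds]
  intro O hO hx
  obtain ⟨u, v, -, hv, hu, hzv, huv⟩ := generalized_tube_lemma isCompact_univ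
    (isCompact_singleton (x := z)) (hO.preimage hK) (by
      rintro ⟨y, w⟩ ⟨-, rfl⟩
      change K (y, w) ∈ O
      rwa [h])
  filter_upwards [hT (hv.mem_nhds (hzv rfl))] with w hw
  exact huv ⟨hu (mem_univ _), hw⟩

theorem Path.trans_apply_of_eq_half {x y z : X} (p : Path x y) (q : Path y z) {s t : I}
    (h : (s : ℝ) = t / 2) : p.trans q s = p t := by
  rw [Path.trans_apply, dif_pos (by linarith [t.2.2])]
  congr 1
  ext
  change 2 * (s : ℝ) = t
  linarith

theorem Path.trans_apply_of_eq_half_add {x y z : X} (p : Path x y) (q : Path y z) {s t : I}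
    (h : (s : ℝ) = (1 + t) / 2) : p.trans q s = q t := by
  rw [Path.trans_apply]
  split_ifs with hs
  · have h0 : t = 0 := by
      ext
      rw [Icc.coe_zero]
      linarith [t.2.1]
    subst h0
    rw [q.source]
    refine Eq.trans ?_ p.target
    congr 1
    ext
    change 2 * (s : ℝ) = 1
    rw [h, Icc.coe_zero]
    norm_num
  · congr 1
    ext
    change 2 * (s : ℝ) - 1 = t
    linarith

/-- A commutative square of path classes can be filled. -/
theorem exists_square {x y x' y' : X} (p : Path x y) (p' : Path x' y') (δ : Path x x')
    (ε : Path y y') (h : (p.trans ε).Homotopic (δ.trans p')) : ∃ F : C(I × I, X),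
      (∀ t, F (0, t) = p t) ∧ (∀ t, F (1, t) = p' t) ∧ (∀ s, F (s, 0) = δ s) ∧
        ∀ s, F (s, 1) = ε s := by
  obtain ⟨K⟩ := h
  -- On the antidiagonal where `q.1 + q.2` is fixed, the path parameter `T` is constant and `q.1 -
  -- q.2` ranges over `[-μ, μ]`; `S` rescales this to `[0, 1]`. Then `S = 0` on the two sides
  -- carrying `p` and `ε`, and `S = 1` on those carrying `δ` and `p'`.
  let μ : I × I → ℝ := fun q => min ((q.1 : ℝ) + q.2) (2 - (q.1 + q.2))
  let S : I × I → I := fun q => projIcc 0 1 zero_le_one ((1 + (q.1 - q.2) / μ q) / 2)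
  let T : I × I → I := fun q => ⟨((q.1 : ℝ) + q.2) / 2, by
    constructor <;> linarith [q.1.2.1, q.1.2.2, q.2.2.1, q.2.2.2]⟩
  have hT : Continuous T := by fun_prop
  have hμ : Continuous μ := by fun_prop
  have hS0 : ∀ q, (1 + ((q.1 : ℝ) - q.2) / μ q) / 2 = 0 → S q = 0 := fun q hq => by
    simp only [S, hq, projIcc_left]
    rfl
  have hS1 : ∀ q, (1 + ((q.1 : ℝ) - q.2) / μ q) / 2 = 1 → S q = 1 := fun q hq => by
    simp only [S, hq, projIcc_right]
    rfl
  have hT0 : ∀ q : I × I, (q.1 : ℝ) + q.2 = 0 → T q = 0 := fun q hq => by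
    ext
    simp [T, hq]
  have hT1 : ∀ q : I × I, (q.1 : ℝ) + q.2 = 2 → T q = 1 := fun q hq => by
    ext
    simp [T, hq]
  have hK0 : ∀ s, K (s, 0) = x := K.source
  have hK1 : ∀ s, K (s, 1) = y' := K.target
  have hcont : Continuous fun q => K (S q, T q) := by
    rw [continuous_iff_continuousAt]
    intro q
    -- At the corners `(0, 0)` and `(1, 1)` the value of `S` is arbitrary, but there `K` does not
    -- depend on it: the homotopy fixes endpoints.
    by_cases hq : μ q = 0
    · have hq' : (q.1 : ℝ) + q.2 = 0 ∨ (q.1 : ℝ) + q.2 = 2 := by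
        rcases min_choice ((q.1 : ℝ) + q.2) (2 - (q.1 + q.2)) with h | h
        · exact .inl (h.symm.trans hq)
        · right
          linarith [h.symm.trans hq]
      rcases hq' with h | h
      · have e := hT0 q h
        have := hT.tendsto q
        rw [e] at this
        rw [ContinuousAt, e, hK0]
        exact tendsto_of_forall_eq K.continuous hK0 S this
      · have e := hT1 q h
        have := hT.tendsto q
        rw [e] at this
        rw [ContinuousAt, e, hK1]
        exact tendsto_of_forall_eq K.continuous hK1 S this
    · have hS : ContinuousAt S q := by
        refine continuous_projIcc.continuousAt.comp ?_
        refine (continuousAt_const.add (ContinuousAt.div ?_ hμ.continuousAt hq)).div_const 2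
        fun_prop
      exact K.continuous.continuousAt.comp (hS.prodMk hT.continuousAt)
  have left : ∀ q : I × I, K (0, q.2) = (p.trans ε) q.2 := fun q => K.apply_zero q.2
  have right : ∀ q : I × I, K (1, q.2) = (δ.trans p') q.2 := fun q => K.apply_one q.2
  refine ⟨⟨_, hcont⟩, fun t => ?_, fun t => ?_, fun s => ?_, fun s => ?_⟩ <;>
    simp only [ContinuousMap.coe_mk]
  · rcases eq_or_ne t 0 with rfl | ht
    · rw [hT0 _ (by simp), hK0, p.source]
    · have ht' : (t : ℝ) ≠ 0 := fun h => ht (Subtype.ext h)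
      have e : μ (0, t) = t := by
        simp only [μ, Icc.coe_zero, zero_add]
        exact min_eq_left (by linarith [t.2.2])
      have e' : (1 + (((0 : I) : ℝ) - t) / μ (0, t)) / 2 = 0 := by
        rw [e, Icc.coe_zero]
        field_simp
        ring
      rw [hS0 _ e', left (0, T (0, t)), Path.trans_apply_of_eq_half]
      simp [T]
  · rcases eq_or_ne t 1 with rfl | ht
    · rw [hT1 _ (by simp; norm_num), hK1, p'.target]
    · have ht' : 1 - (t : ℝ) ≠ 0 := fun h => ht (Subtype.ext (sub_eq_zero.1 h).symm)
      have e : μ (1, t) = 1 - t := by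
        simp only [μ, Icc.coe_one]
        rw [min_eq_right (by linarith [t.2.1])]
        ring
      have e' : (1 + (((1 : I) : ℝ) - t) / μ (1, t)) / 2 = 1 := by
        rw [e, Icc.coe_one]
        field_simp
        ring
      rw [hS1 _ e', right (0, T (1, t)), Path.trans_apply_of_eq_half_add]
      simp [T]
  · rcases eq_or_ne s 0 with rfl | hs
    · rw [hT0 _ (by simp), hK0, δ.source]
    · have hs' : (s : ℝ) ≠ 0 := fun h => hs (Subtype.ext h)
      have e : μ (s, 0) = s := by
        simp only [μ, Icc.coe_zero, add_zero]
        exact min_eq_left (by linarith [s.2.2])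
      have e' : (1 + ((s : ℝ) - (0 : I)) / μ (s, 0)) / 2 = 1 := by
        rw [e, Icc.coe_zero]
        field_simp
        ring
      rw [hS1 _ e', right (0, T (s, 0)), Path.trans_apply_of_eq_half]
      simp [T]
  · rcases eq_or_ne s 1 with rfl | hs
    · rw [hT1 _ (by simp; norm_num), hK1, ε.target]
    · have hs' : 1 - (s : ℝ) ≠ 0 := fun h => hs (Subtype.ext (sub_eq_zero.1 h).symm)
      have e : μ (s, 1) = 1 - s := by
        simp only [μ, Icc.coe_one]
        rw [min_eq_right (by linarith [s.2.1])]
        ring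
      have e' : (1 + ((s : ℝ) - (1 : I)) / μ (s, 1)) / 2 = 0 := by
        rw [e, Icc.coe_one]
        field_simp
        ring
      rw [hS0 _ e', left (0, T (s, 1)), Path.trans_apply_of_eq_half_add]
      simp [T, add_comm]

end Paths

/-! ## Edge paths -/

section EdgePaths

variable {X : Type u} [TopologicalSpace X] [CWComplex (univ : Set X)]

theorem isEdgePath_of_bijOn {γ : I → X} (hγ : Continuous γ) {e : cell (univ : Set X) 1}
    (h : BijOn γ (Ioo 0 1) (openCell 1 e)) : IsEdgePath γ := by
  refine ⟨hγ, .inr ⟨1, ![0, 1], ?_, rfl, rfl, fun i => ⟨e, ?_⟩⟩⟩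
  · rw [Fin.strictMono_iff_lt_succ]
    intro i
    rw [Subsingleton.elim i 0]
    exact zero_lt_one
  · rw [Subsingleton.elim i 0]
    exact h

/-- Path classes that are products of edges. -/
inductive EdgeWord : ∀ {x y : X}, Path.Homotopic.Quotient x y → Prop
  | nil {x : X} (hx : x ∈ graphVertices X) : EdgeWord (.refl x)
  | cons {x y z : X} (hx : x ∈ graphVertices X) (p : Path x y) (e : cell (univ : Set X) 1)
      (hp : BijOn p (Ioo 0 1) (openCell 1 e)) {q : Path.Homotopic.Quotient y z}
      (hq : EdgeWord q) : EdgeWord ((Path.Homotopic.Quotient.mk p).trans q)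

namespace EdgeWord

theorem source_mem {x y : X} {q : Path.Homotopic.Quotient x y} (hq : EdgeWord q) :
    x ∈ graphVertices X := by
  cases hq <;> assumption

theorem trans {x y z : X} {p : Path.Homotopic.Quotient x y} {q : Path.Homotopic.Quotient y z}
    (hp : EdgeWord p) (hq : EdgeWord q) : EdgeWord (p.trans q) := by
  induction hp with
  | nil hx => rwa [Path.Homotopic.Quotient.refl_trans]
  | cons hx p e hp _ ih =>
    rw [Path.Homotopic.Quotient.trans_assoc]
    exact cons hx p e hp (ih hq)

theorem single {x y : X} (hx : x ∈ graphVertices X) (hy : y ∈ graphVertices X) (p : Path x y)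
    (e : cell (univ : Set X) 1) (hp : BijOn p (Ioo 0 1) (openCell 1 e)) :
    EdgeWord (Path.Homotopic.Quotient.mk p) := by
  rw [← Path.Homotopic.Quotient.trans_refl (.mk p)]
  exact cons hx p e hp (nil hy)

theorem bijOn_symm : BijOn unitInterval.symm (Ioo 0 1) (Ioo 0 1) := by
  refine InvOn.bijOn (f' := unitInterval.symm)
    ⟨fun t _ => unitInterval.symm_symm t, fun t _ => unitInterval.symm_symm t⟩ ?_ ?_ <;>
  · rintro t ⟨h0, h1⟩
    have h0' : (0 : ℝ) < t := h0
    have h1' : (t : ℝ) < 1 := h1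
    constructor
    · change (0 : ℝ) < 1 - t
      linarith
    · change (1 : ℝ) - t < 1
      linarith

theorem symm {x y : X} {p : Path.Homotopic.Quotient x y} (hp : EdgeWord p) : EdgeWord p.symm := by
  induction hp with
  | nil hx =>
    rw [Path.Homotopic.Quotient.symm_refl]
    exact nil hx
  | cons hx p e hp hq ih =>
    rw [Path.Homotopic.Quotient.symm_of_trans, ← Path.Homotopic.Quotient.mk_symm]
    exact ih.trans (single hq.source_mem hx p.symm e (hp.comp bijOn_symm))

theorem bijOn_of_comp {α β γ : Type*} {f : β → γ} {h : α → β} {A : Set α} {B : Set γ}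
    (hf : BijOn (f ∘ h) A B) : BijOn f (h '' A) B := by
  refine ⟨?_, hf.injOn.image_of_comp, ?_⟩
  · rintro _ ⟨a, ha, rfl⟩
    exact hf.mapsTo ha
  · rw [SurjOn, ← image_comp]
    exact hf.surjOn

/-- The map `t ↦ t / 2`. -/
noncomputable def lowerHalf (t : I) : I :=
  ⟨t / 2, by constructor <;> linarith [t.2.1, t.2.2]⟩

/-- The map `t ↦ (1 + t) / 2`. -/
noncomputable def upperHalf (t : I) : I :=
  ⟨(1 + t) / 2, by constructor <;> linarith [t.2.1, t.2.2]⟩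

theorem lowerHalf_image_Ioo : lowerHalf '' Ioo 0 1 = Ioo 0 (upperHalf 0) := by
  ext s
  constructor
  · rintro ⟨t, ⟨h0, h1⟩, rfl⟩
    have h0' : (0 : ℝ) < t := h0
    have h1' : (t : ℝ) < 1 := h1
    constructor
    · change (0 : ℝ) < t / 2
      linarith
    · change (t : ℝ) / 2 < (1 + (0 : I)) / 2
      rw [Icc.coe_zero]
      linarith
  · rintro ⟨h0, h1⟩
    have h0' : (0 : ℝ) < s := h0
    have h1' : (s : ℝ) < (1 + (0 : I)) / 2 := h1
    rw [Icc.coe_zero] at h1'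
    refine ⟨⟨2 * s, by constructor <;> linarith⟩, ⟨?_, ?_⟩, ?_⟩
    · change (0 : ℝ) < 2 * s
      linarith
    · change 2 * (s : ℝ) < 1
      linarith
    · ext
      simp [lowerHalf]

theorem upperHalf_strictMono : StrictMono upperHalf := by
  intro s t h
  have h' : (s : ℝ) < t := h
  change (1 + (s : ℝ)) / 2 < (1 + t) / 2
  linarith

theorem upperHalf_image_Ioo (a b : I) : upperHalf '' Ioo a b = Ioo (upperHalf a) (upperHalf b) := by
  ext s
  constructor
  · rintro ⟨t, ⟨h0, h1⟩, rfl⟩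
    exact ⟨upperHalf_strictMono h0, upperHalf_strictMono h1⟩
  · rintro ⟨h0, h1⟩
    have h0' : (1 + (a : ℝ)) / 2 < s := h0
    have h1' : (s : ℝ) < (1 + b) / 2 := h1
    refine ⟨⟨2 * s - 1, by constructor <;> linarith [a.2.1, b.2.2]⟩, ⟨?_, ?_⟩, ?_⟩
    · change (a : ℝ) < 2 * s - 1
      linarith
    · change 2 * (s : ℝ) - 1 < b
      linarith
    · ext
      simp [upperHalf]

/-- A product of edges is represented by an edge path. -/
theorem exists_isEdgePath {x y : X} {q : Path.Homotopic.Quotient x y} (hq : EdgeWord q) :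
    ∃ γ : Path x y, IsEdgePath γ ∧ Path.Homotopic.Quotient.mk γ = q := by
  induction hq with
  | nil hx => exact ⟨Path.refl _, ⟨Path.continuous _, .inl ⟨_, hx, fun _ => rfl⟩⟩, rfl⟩
  | @cons x y z hx p e hp q hq ih =>
    obtain ⟨γ, ⟨-, ⟨v, -, hγ⟩ | ⟨r, s, hs, hs0, hs1, hγ⟩⟩, rfl⟩ := ih
    -- A constant tail contributes no interval to the subdivision, so it is dropped and `p` alone is
    -- the edge path.
    · obtain rfl : y = z :=
        γ.source.symm.trans ((hγ 0).trans ((hγ 1).symm.trans γ.target))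
      obtain rfl : γ = Path.refl y := by
        ext t
        rw [hγ, ← hγ 0, γ.source]
        rfl
      refine ⟨p, isEdgePath_of_bijOn p.continuous hp, ?_⟩
      rw [Path.Homotopic.Quotient.mk_refl, Path.Homotopic.Quotient.trans_refl]
    -- The breakpoints are `0` followed by the old ones moved into the upper half; the old `0`
    -- becomes `1 / 2`, where `p` ends.
    · refine ⟨p.trans γ, ⟨Path.continuous _, .inr ⟨r + 1,
        Fin.cons 0 fun i => upperHalf (s i), ?_, rfl, ?_, fun i => ?_⟩⟩,
        Path.Homotopic.Quotient.mk_trans p γ⟩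
      · rw [Fin.strictMono_iff_lt_succ]
        intro i
        induction i using Fin.cases with
        | zero =>
          change (0 : ℝ) < (1 + s 0) / 2
          linarith [(s 0).2.1]
        | succ j =>
          rw [← Fin.succ_castSucc, Fin.cons_succ, Fin.cons_succ]
          exact upperHalf_strictMono (hs (Fin.castSucc_lt_succ))
      · rw [← Fin.succ_last, Fin.cons_succ, hs1]
        ext
        simp [upperHalf]
      · induction i using Fin.cases with
        | zero =>
          refine ⟨e, ?_⟩
          rw [Fin.castSucc_zero, Fin.cons_zero, Fin.cons_succ, hs0, ← lowerHalf_image_Ioo]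
          refine bijOn_of_comp (hp.congr fun t _ => ?_)
          exact (Path.trans_apply_of_eq_half p γ rfl).symm
        | succ j =>
          obtain ⟨e', he'⟩ := hγ j
          refine ⟨e', ?_⟩
          rw [← Fin.succ_castSucc, Fin.cons_succ, Fin.cons_succ, ← upperHalf_image_Ioo]
          refine bijOn_of_comp (he'.congr fun t _ => ?_)
          exact (Path.trans_apply_of_eq_half_add p γ rfl).symm

end EdgeWord

/-! ### Segments in edges -/

instance unitInterval.instContractibleSpace : ContractibleSpace I :=
  (convex_Icc (0 : ℝ) 1).contractibleSpace ⟨0, by simp⟩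

/-- The class of paths from `a` to `b` in the edge `e`. -/
noncomputable def edgeSegment (e : cell (univ : Set X) 1) (a b : I) :
    Path.Homotopic.Quotient (edgeParam e a) (edgeParam e b) :=
  .mk ((PathConnectedSpace.somePath a b).map (continuous_edgeParam e))

/-- `I` is simply connected, so the path chosen in `edgeSegment` is immaterial; the groupoid laws
for segments follow. -/
theorem mk_map_edgeParam (e : cell (univ : Set X) 1) {a b : I} (ρ : Path a b) :
    Path.Homotopic.Quotient.mk (ρ.map (continuous_edgeParam e)) = edgeSegment e a b :=
  Path.Homotopic.Quotient.eq.2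
    ((SimplyConnectedSpace.paths_homotopic ρ _).map ⟨_, continuous_edgeParam e⟩)

theorem edgeSegment_trans (e : cell (univ : Set X) 1) (a b c : I) :
    (edgeSegment e a b).trans (edgeSegment e b c) = edgeSegment e a c := by
  rw [edgeSegment, edgeSegment, ← Path.Homotopic.Quotient.mk_trans, ← Path.map_trans,
    mk_map_edgeParam]

theorem edgeSegment_self (e : cell (univ : Set X) 1) (a : I) :
    edgeSegment e a a = .refl (edgeParam e a) := by
  rw [← mk_map_edgeParam e (Path.refl a)]
  rfl

theorem edgeSegment_symm (e : cell (univ : Set X) 1) (a b : I) :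
    (edgeSegment e a b).symm = edgeSegment e b a := by
  rw [edgeSegment, ← Path.Homotopic.Quotient.mk_symm, Path.map_symm, mk_map_edgeParam]

theorem edgeWord_edgeSegment_zero_one (e : cell (univ : Set X) 1) :
    EdgeWord (edgeSegment e 0 1) := by
  rw [← mk_map_edgeParam e Path.id]
  exact .single (edgeParam_zero_mem e) (edgeParam_one_mem e) _ e (bijOn_edgeParam e)

theorem edgeWord_edgeSegment (e : cell (univ : Set X) 1) {a b : I} (ha : a = 0 ∨ a = 1)
    (hb : b = 0 ∨ b = 1) : EdgeWord (edgeSegment e a b) := by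
  rcases ha with rfl | rfl <;> rcases hb with rfl | rfl
  · rw [edgeSegment_self]
    exact .nil (edgeParam_zero_mem e)
  · exact edgeWord_edgeSegment_zero_one e
  · rw [← edgeSegment_symm]
    exact (edgeWord_edgeSegment_zero_one e).symm
  · rw [edgeSegment_self]
    exact .nil (edgeParam_one_mem e)

/-- Straight path classes from a vertex to a point. -/
inductive IsTether : ∀ {v x : X}, Path.Homotopic.Quotient v x → Prop
  | refl {x : X} (hx : x ∈ graphVertices X) : IsTether (.refl x)
  | segment (e : cell (univ : Set X) 1) (a t : I) (ha : a = 0 ∨ a = 1) :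
      IsTether (edgeSegment e a t)

theorem IsTether.edgeWord {v x : X} {α : Path.Homotopic.Quotient v x} (h : IsTether α)
    (hx : x ∈ graphVertices X) : EdgeWord α := by
  cases h with
  | refl hx => exact .nil hx
  | segment e a t ha =>
    refine edgeWord_edgeSegment e ha ?_
    rcases mem_Ioo_or_eq t with ht | ht | ht
    · exact .inl ht
    · exact .inr ht
    · exact absurd hx (edgeParam_notMem_graphVertices e ht)

theorem IsTether.exists_eq {v x : X} {α : Path.Homotopic.Quotient v x} (h : IsTether α)
    {e : cell (univ : Set X) 1} {t : I} (ht : t ∈ Ioo (0 : I) 1) (hx : edgeParam e t = x) :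
    ∃ a, ∃ hv : v = edgeParam e a, (a = 0 ∨ a = 1) ∧ α = (edgeSegment e a t).cast hv hx.symm := by
  cases h with
  | refl h => exact absurd (hx ▸ h) (edgeParam_notMem_graphVertices e ht)
  | segment e' a t' ha =>
    obtain ⟨rfl, rfl⟩ := edgeParam_eq_edgeParam ht hx
    exact ⟨a, rfl, ha, by rw [Path.Homotopic.Quotient.cast_rfl_rfl]⟩

/-- Path classes that become products of edges after joining the endpoints to vertices. -/
def IsNearEdgeWord {x y : X} (q : Path.Homotopic.Quotient x y) : Prop :=
  ∃ (v w : X) (α : Path.Homotopic.Quotient v x) (β : Path.Homotopic.Quotient w y),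
    IsTether α ∧ IsTether β ∧ EdgeWord (α.trans (q.trans β.symm))

namespace IsNearEdgeWord

theorem segment (e : cell (univ : Set X) 1) (a b : I) : IsNearEdgeWord (edgeSegment e a b) := by
  refine ⟨_, _, _, _, .segment e 0 a (.inl rfl), .segment e 0 b (.inl rfl), ?_⟩
  rw [edgeSegment_symm, edgeSegment_trans, edgeSegment_trans, edgeSegment_self]
  exact .nil (edgeParam_zero_mem e)

/-- Between vertices the tethers are themselves products of edges and can be cancelled. -/
theorem edgeWord {v w : X} {q : Path.Homotopic.Quotient v w} (h : IsNearEdgeWord q)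
    (hv : v ∈ graphVertices X) (hw : w ∈ graphVertices X) : EdgeWord q := by
  obtain ⟨v', w', α, β, hα, hβ, h⟩ := h
  have := (hα.edgeWord hv).symm.trans (h.trans (hβ.edgeWord hw))
  simpa only [Path.Homotopic.Quotient.trans_assoc, Path.Homotopic.Quotient.symm_trans_cancel,
    Path.Homotopic.Quotient.symm_trans, Path.Homotopic.Quotient.trans_refl] using this

theorem of_lift {x y : X} (γ : Path x y) (e : cell (univ : Set X) 1) (ρ : I → I)
    (hρ : Continuous ρ) (h : ∀ t, γ t = edgeParam e (ρ t)) :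
    IsNearEdgeWord (Path.Homotopic.Quotient.mk γ) := by
  obtain rfl : x = edgeParam e (ρ 0) := by rw [← h, γ.source]
  obtain rfl : y = edgeParam e (ρ 1) := by rw [← h, γ.target]
  have : γ = Path.map ⟨⟨ρ, hρ⟩, rfl, rfl⟩ (continuous_edgeParam e) := by
    ext t
    exact h t
  rw [this, mk_map_edgeParam]
  exact segment e _ _

/-- The inverse of the characteristic map is continuous on the open edge and lifts the path to `I`.
-/
theorem of_openCell {x y : X} (γ : Path x y) (e : cell (univ : Set X) 1)
    (h : ∀ t, γ t ∈ openCell 1 e) : IsNearEdgeWord (Path.Homotopic.Quotient.mk γ) := by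
  have htarget : openCell 1 e = (map 1 e).target := by
    rw [← (map 1 e).image_source_eq_target, source_eq]
    rfl
  let τ : I → ℝ := fun t => (map 1 e).symm (γ t) 0
  have hτ : Continuous τ := by
    refine (continuous_apply 0).comp ?_
    refine (continuousOn_symm 1 e).comp_continuous γ.continuous fun t => ?_
    rw [← htarget]
    exact h t
  have hτI : ∀ t, |τ t| < 1 := fun t => by
    have : (map 1 e).symm (γ t) ∈ Metric.ball (0 : Fin 1 → ℝ) 1 := by
      rw [← source_eq 1 e]
      exact (map 1 e).map_target (htarget ▸ h t)
    rw [mem_ball_zero_iff, pi_norm_lt_iff zero_lt_one] at this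
    exact this 0
  have hmem : ∀ t, (τ t + 1) / 2 ∈ I := fun t => by
    have := abs_lt.1 (hτI t)
    constructor <;> linarith
  refine of_lift γ e (fun t => ⟨(τ t + 1) / 2, hmem t⟩)
    (Continuous.subtype_mk (by fun_prop) hmem) fun t => ?_
  have e1 : (fun _ : Fin 1 => 2 * ((τ t + 1) / 2) - 1) = (map 1 e).symm (γ t) := by
    ext i
    rw [Subsingleton.elim i 0]
    simp only [τ]
    ring
  simp only [edgeParam, e1]
  exact ((map 1 e).right_inv (htarget ▸ h t)).symm

theorem cast_iff {x y x' y' : X} {q : Path.Homotopic.Quotient x y} (hx : x' = x)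
    (hy : y' = y) : IsNearEdgeWord (q.cast hx hy) ↔ IsNearEdgeWord q := by
  subst hx hy
  rw [Path.Homotopic.Quotient.cast_rfl_rfl]

variable [IsTopGraph X]

/-- Two tethers at the same point differ by a product of edges. This is what makes being near an
edge word stable under concatenation at points inside an edge. -/
theorem _root_.IsTether.trans_symm {v w x : X} {α : Path.Homotopic.Quotient v x}
    {β : Path.Homotopic.Quotient w x} (hα : IsTether α) (hβ : IsTether β) :
    EdgeWord (α.trans β.symm) := by
  rcases mem_graphVertices_or x with hx | ⟨e, t, ht, rfl⟩
  · exact (hα.edgeWord hx).trans (hβ.edgeWord hx).symm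
  · obtain ⟨a, rfl, ha, rfl⟩ := hα.exists_eq ht rfl
    obtain ⟨b, rfl, hb, rfl⟩ := hβ.exists_eq ht rfl
    rw [Path.Homotopic.Quotient.cast_rfl_rfl, Path.Homotopic.Quotient.cast_rfl_rfl,
      edgeSegment_symm, edgeSegment_trans]
    exact edgeWord_edgeSegment e ha hb

theorem trans {x y z : X} {p : Path.Homotopic.Quotient x y} {q : Path.Homotopic.Quotient y z}
    (hp : IsNearEdgeWord p) (hq : IsNearEdgeWord q) : IsNearEdgeWord (p.trans q) := by
  obtain ⟨v, w, α, β, hα, hβ, hw⟩ := hp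
  obtain ⟨v', w', α', β', hα', hβ', hw'⟩ := hq
  refine ⟨v, w', α, β', hα, hβ', ?_⟩
  have h := hw.trans ((hβ.trans_symm hα').trans hw')
  simpa only [Path.Homotopic.Quotient.trans_assoc, Path.Homotopic.Quotient.symm_trans_cancel]
    using h

theorem refl (x : X) : IsNearEdgeWord (Path.Homotopic.Quotient.refl x) := by
  rcases mem_graphVertices_or x with hx | ⟨e, t, ht, rfl⟩
  · refine ⟨_, _, _, _, .refl hx, .refl hx, ?_⟩
    rw [Path.Homotopic.Quotient.symm_refl, Path.Homotopic.Quotient.refl_trans,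
      Path.Homotopic.Quotient.refl_trans]
    exact .nil hx
  · rw [← edgeSegment_self]
    exact segment e t t

theorem of_const {x y : X} (γ : Path x y) (v : X) (h : ∀ t, γ t = v) :
    IsNearEdgeWord (Path.Homotopic.Quotient.mk γ) := by
  obtain rfl : v = x := by rw [← h 0, γ.source]
  obtain rfl : v = y := by rw [← h 1, γ.target]
  have : γ = Path.refl v := by
    ext t
    exact h t
  rw [this]
  exact refl v

end IsNearEdgeWord

/-! ### Edge approximation of arbitrary paths -/

variable [IsTopGraph X]

theorem isOpen_openCell_one (e : cell (univ : Set X) 1) : IsOpen (openCell 1 e) := by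
  refine isOpen_of_edgeParam fun e' => ?_
  by_cases h : e' = e
  · subst h
    convert isOpen_Ioo (a := (0 : I)) (b := 1) using 1
    ext t
    refine ⟨fun ht => ?_, fun ht => edgeParam_mem_openCell _ ht⟩
    rcases mem_Ioo_or_eq t with rfl | rfl | h
    · exact absurd (edgeParam_zero_mem _) ((disjoint_openCell_graphVertices _).notMem_of_mem_left ht)
    · exact absurd (edgeParam_one_mem _) ((disjoint_openCell_graphVertices _).notMem_of_mem_left ht)
    · exact h
  · convert isOpen_empty using 1
    ext t
    refine ⟨fun ht => ?_, fun ht => ht.elim⟩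
    obtain ⟨s, hs, hst⟩ := (bijOn_edgeParam e).surjOn ht
    exact h (edgeParam_eq_edgeParam hs hst).1.symm

theorem isClosed_of_subset_graphVertices {S : Set X} (h : S ⊆ graphVertices X) : IsClosed S := by
  refine isClosed_of_edgeParam fun e => Finite.isClosed ?_
  refine (toFinite {0, 1}).subset fun t ht => ?_
  rcases mem_Ioo_or_eq t with rfl | rfl | h'
  · exact .inl rfl
  · exact .inr rfl
  · exact absurd (h ht) (edgeParam_notMem_graphVertices e h')

/-- Every set of vertices is closed, so the vertices form a discrete subspace, and `I` is connected.
-/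
theorem eq_of_forall_mem_graphVertices {f : I → X} (hf : Continuous f)
    (h : ∀ t, f t ∈ graphVertices X) (t : I) : f t = f 0 := by
  have hc : IsClopen (f ⁻¹' {f 0}) := by
    refine ⟨(isClosed_of_subset_graphVertices (singleton_subset_iff.2 (h 0))).preimage hf, ?_⟩
    rw [← isClosed_compl_iff]
    convert (isClosed_of_subset_graphVertices
      (sdiff_subset : graphVertices X \ {f 0} ⊆ _)).preimage hf using 1
    ext t
    simp [h t]
  exact (hc.eq_univ ⟨0, rfl⟩).symm.subset (mem_univ t)

/-- The complement of the middle thirds of the edges. -/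
def vertexStars (X : Type u) [TopologicalSpace X] [CWComplex (univ : Set X)] : Set X :=
  {x | ∀ (e : cell (univ : Set X) 1) (t : I), edgeParam e t = x →
    ¬ (1 / 3 ≤ (t : ℝ) ∧ (t : ℝ) ≤ 2 / 3)}

theorem isOpen_vertexStars : IsOpen (vertexStars X) := by
  refine isOpen_of_edgeParam fun e => ?_
  have : edgeParam e ⁻¹' vertexStars X = {t : I | 1 / 3 ≤ (t : ℝ) ∧ (t : ℝ) ≤ 2 / 3}ᶜ := by
    ext t
    refine ⟨fun h => h e t rfl, fun h e' t' ht' hI => ?_⟩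
    have hIoo : t' ∈ Ioo (0 : I) 1 := by
      constructor
      · change (0 : ℝ) < t'
        linarith
      · change (t' : ℝ) < 1
        linarith
    obtain ⟨rfl, rfl⟩ := edgeParam_eq_edgeParam hIoo ht'
    exact h hI
  rw [this, isOpen_compl_iff]
  exact (isClosed_le continuous_const continuous_subtype_val).inter
    (isClosed_le continuous_subtype_val continuous_const)

/-- A homotopy that moves the outer thirds of the edges into the vertices, along the edges. -/
theorem exists_squeeze : ∃ F : C(I × X, X), (∀ x, F (0, x) = x) ∧
    (∀ x ∈ vertexStars X, F (1, x) ∈ graphVertices X) ∧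
    ∀ x, (∀ s, F (s, x) = x) ∨
      ∃ e, ∃ ρ : I → I, Continuous ρ ∧ ∀ s, F (s, x) = edgeParam e (ρ s) := by
  -- `c` clamps `3 t - 1` to `[0, 1]`: it collapses the outer thirds to the endpoints and stretches
  -- the middle third. `sq` is the straight-line homotopy from the identity to `c`.
  let c : I → I := fun t => projIcc 0 1 zero_le_one (3 * t - 1)
  have hc : Continuous c := continuous_projIcc.comp (by fun_prop)
  have hc0 : ∀ t : I, (t : ℝ) < 1 / 3 → c t = 0 := fun t ht =>
    projIcc_of_le_left _ (by linarith)
  have hc1 : ∀ t : I, 2 / 3 < (t : ℝ) → c t = 1 := fun t ht =>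
    projIcc_of_right_le _ (by linarith)
  let sq : I × I → I := fun q => ⟨(1 - q.1) * q.2 + q.1 * c q.2,
    (convex_Icc (0 : ℝ) 1) q.2.2 (c q.2).2 (by linarith [q.1.2.2]) q.1.2.1 (by ring)⟩
  have hsq : Continuous sq := by fun_prop
  have hsq0 : ∀ t, sq (0, t) = t := fun t => by
    ext
    simp [sq]
  have hsq1 : ∀ t, sq (1, t) = c t := fun t => by
    ext
    simp [sq]
  obtain ⟨F, hv, he⟩ := exists_homotopy_glue (X := X) (fun x => ContinuousMap.const I x)
    (fun e => ⟨fun q => edgeParam e (sq q), (continuous_edgeParam e).comp hsq⟩)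
    (fun e s => by
      change edgeParam e (sq (s, 0)) = edgeParam e 0
      congr 1
      ext
      simp [sq, hc0])
    (fun e s => by
      change edgeParam e (sq (s, 1)) = edgeParam e 1
      congr 1
      ext
      have : c 1 = 1 := hc1 1 (by simp; norm_num)
      simp [sq, this])
  have he' : ∀ e s t, F (s, edgeParam e t) = edgeParam e (sq (s, t)) := he
  refine ⟨F, fun x => ?_, fun x hx => ?_, fun x => ?_⟩
  · rcases mem_graphVertices_or x with h | ⟨e, t, -, rfl⟩
    · exact hv x h 0
    · rw [he', hsq0]
  · rcases mem_graphVertices_or x with h | ⟨e, t, -, rfl⟩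
    · rw [hv x h]
      exact h
    · rw [he', hsq1]
      have := hx e t rfl
      by_cases h : (t : ℝ) < 1 / 3
      · rw [hc0 t h]
        exact edgeParam_zero_mem e
      · rw [hc1 t]
        · exact edgeParam_one_mem e
        · by_contra h'
          exact this ⟨not_lt.1 h, not_lt.1 h'⟩
  · rcases mem_graphVertices_or x with h | ⟨e, t, -, rfl⟩
    · exact .inl fun s => hv x h s
    · exact .inr ⟨e, fun s => sq (s, t), by fun_prop, fun s => he' e s t⟩

/-- Squeezing moves the path into the discrete vertex set, where it is constant. By naturality of
the homotopy, the path is the track of `x`, a constant path and the reversed track of `y`, and each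
track stays in one edge or is constant. -/
theorem IsNearEdgeWord.of_vertexStars {x y : X} (γ : Path x y) (h : ∀ t, γ t ∈ vertexStars X) :
    IsNearEdgeWord (Path.Homotopic.Quotient.mk γ) := by
  obtain ⟨F, hF0, hF1, hF⟩ := exists_squeeze (X := X)
  let g : C(X, X) := F.comp ((ContinuousMap.const X 1).prodMk (ContinuousMap.id X))
  let H : (ContinuousMap.id X).Homotopy g := ⟨F, hF0, fun _ => rfl⟩
  have hev : ∀ z, IsNearEdgeWord (Path.Homotopic.Quotient.mk (H.evalAt z)) ∧
      IsNearEdgeWord (Path.Homotopic.Quotient.mk (H.evalAt z)).symm := by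
    intro z
    rw [← Path.Homotopic.Quotient.mk_symm]
    rcases hF z with hz | ⟨e, ρ, hρ, hz⟩
    · exact ⟨.of_const _ z hz, .of_const _ z fun t => hz _⟩
    · exact ⟨.of_lift _ e ρ hρ hz, .of_lift _ e (ρ ∘ unitInterval.symm)
        (hρ.comp unitInterval.continuous_symm) fun t => hz _⟩
  have hconst : IsNearEdgeWord (Path.Homotopic.Quotient.mk (γ.map g.continuous)) :=
    .of_const _ _ fun t => eq_of_forall_mem_graphVertices (g.continuous.comp γ.continuous)
      (fun t => hF1 _ (h t)) t
  have key := H.mk_map_trans_evalAt (.mk γ)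
  have key' : Path.Homotopic.Quotient.mk γ = ((Path.Homotopic.Quotient.mk (H.evalAt x)).trans
      (Path.Homotopic.Quotient.mk (γ.map g.continuous))).trans
        (Path.Homotopic.Quotient.mk (H.evalAt y)).symm := by
    rw [Path.Homotopic.Quotient.mk_map, ← key, Path.Homotopic.Quotient.trans_assoc,
      Path.Homotopic.Quotient.trans_symm]
    exact (Path.Homotopic.Quotient.trans_refl _).symm
  rw [key']
  exact ((hev x).1.trans hconst).trans (hev y).2

/-- The open edges and the vertex stars form an open cover; by compactness of `I` the path is
subdivided into pieces that each lie in one member, and the pieces are concatenated. -/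
theorem isNearEdgeWord {x y : X} (q : Path.Homotopic.Quotient x y) : IsNearEdgeWord q := by
  induction q using Path.Homotopic.Quotient.ind with | mk γ =>
  let O : Option (cell (univ : Set X) 1) → Set X := fun o => o.elim (vertexStars X) (openCell 1)
  have hO : ∀ o, IsOpen (O o) := by
    rintro (_ | e)
    exacts [isOpen_vertexStars, isOpen_openCell_one e]
  have hcover : ∀ z : X, ∃ o, z ∈ O o := by
    intro z
    rcases mem_graphVertices_or z with h | ⟨e, t, ht, rfl⟩
    · refine ⟨none, fun e t hz hI => ?_⟩
      refine edgeParam_notMem_graphVertices e (t := t) ?_ (hz ▸ h)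
      constructor
      · change (0 : ℝ) < t
        linarith
      · change (t : ℝ) < 1
        linarith
    · exact ⟨some e, edgeParam_mem_openCell e ht⟩
  obtain ⟨t, ht0, htm, ⟨m, hm⟩, ht⟩ := exists_monotone_Icc_subset_open_cover_unitInterval
    (fun o => (hO o).preimage γ.continuous) fun s _ => by
      obtain ⟨o, ho⟩ := hcover (γ s)
      exact mem_iUnion.2 ⟨o, ho⟩
  have hpiece : ∀ n, IsNearEdgeWord (.mk (γ.subpath (t n) (t (n + 1)))) := by
    intro n
    obtain ⟨o, ho⟩ := ht n
    have hmem : ∀ s, γ.subpath (t n) (t (n + 1)) s ∈ O o := by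
      intro s
      have := mem_range_self (f := γ.subpath (t n) (t (n + 1))) s
      rw [Path.range_subpath_of_le _ _ _ (htm n.le_succ)] at this
      obtain ⟨r, hr, hrs⟩ := this
      rw [← hrs]
      exact ho hr
    rcases o with _ | e
    · exact .of_vertexStars _ hmem
    · exact .of_openCell _ e hmem
  have hind : ∀ n, IsNearEdgeWord (.mk (γ.subpath 0 (t n))) := by
    intro n
    induction n with
    | zero =>
      rw [ht0, Path.subpath_self]
      exact .refl _
    | succ n ih =>
      have := ih.trans (hpiece n)
      rw [← Path.Homotopic.Quotient.mk_trans] at this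
      rwa [← Path.Homotopic.Quotient.eq.2 ⟨Path.Homotopy.subpathTransSubpath γ 0 (t n) _⟩]
  have := hind m
  rw [hm m le_rfl, Path.subpath_zero_one, Path.Homotopic.Quotient.mk_cast,
    IsNearEdgeWord.cast_iff] at this
  exact this

/-- Every path between vertices is homotopic to an edge path. -/
theorem exists_isEdgePath {v w : X} (hv : v ∈ graphVertices X) (hw : w ∈ graphVertices X)
    (q : Path.Homotopic.Quotient v w) :
    ∃ γ : Path v w, IsEdgePath γ ∧ Path.Homotopic.Quotient.mk γ = q :=
  ((isNearEdgeWord q).edgeWord hv hw).exists_isEdgePath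

end EdgePaths

/-! ## Construction of the inverse -/

section Inverse

variable {X : Type u} [TopologicalSpace X] [CWComplex (univ : Set X)]

/-- The characteristic map of an edge as a path. -/
noncomputable def edgeAsPath (e : cell (univ : Set X) 1) : Path (edgeParam e 0) (edgeParam e 1) :=
  ⟨⟨edgeParam e, continuous_edgeParam e⟩, rfl, rfl⟩

/-- A set-theoretic inverse of `g` over `Y`. -/
structure IsPartialInverse (g : C(X, X)) (Y : Set X) (k : X → X) : Prop where
  apply_apply : ∀ y ∈ Y, g (k y) = y
  mem_graphVertices : ∀ v ∈ graphVertices X, k v ∈ graphVertices X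

variable {g : C(X, X)} {Y : Set X} {k : X → X}

theorem IsInvertibleOver.partialInverse_apply (hY : IsInvertibleOver g Y)
    (hk : IsPartialInverse g Y k) {x : X} (hx : g x ∈ Y) : k (g x) = x :=
  (hY.injective _ _ hx (hk.apply_apply _ hx).symm).symm

/-- The preimage of `S` under `k ∘ f` is the preimage under `f` of `g '' S`, and the proper map `g`
is closed. -/
theorem IsInvertibleOver.continuous_partialInverse_comp (hY : IsInvertibleOver g Y)
    (hg : IsProperMap g) (hk : IsPartialInverse g Y k) {f : I → X} (hf : Continuous f)
    (hfY : ∀ t, f t ∈ Y) : Continuous (k ∘ f) := by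
  rw [continuous_iff_isClosed]
  intro S hS
  convert (hg.isClosedMap S hS).preimage hf using 1
  ext t
  refine ⟨fun h => ⟨_, h, hk.apply_apply _ (hfY t)⟩, ?_⟩
  rintro ⟨s, hs, hst⟩
  have : k (f t) = s := by
    rw [← hst]
    exact hY.partialInverse_apply hk (hst ▸ hfY t)
  rwa [mem_preimage, Function.comp_apply, this]

theorem IsInvertibleOver.isEdgePath (hY : IsInvertibleOver g Y) (hg : IsProperMap g)
    (hk : IsPartialInverse g Y k) {e : cell (univ : Set X) 1} (he : closedCell 1 e ⊆ Y) :
    IsEdgePath (k ∘ edgeParam e) := by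
  obtain ⟨e', he'⟩ := hY.exists_edge e he
  refine isEdgePath_of_bijOn (hY.continuous_partialInverse_comp hg hk (continuous_edgeParam e)
    fun t => he (edgeParam_mem_closedCell e t)) (e := e') ?_
  have hmaps : MapsTo g (openCell 1 e') Y := fun x hx =>
    he (RelCWComplex.openCell_subset_closedCell _ _ (he' ▸ mem_image_of_mem g hx))
  have hb : BijOn g (openCell 1 e') (openCell 1 e) := by
    rw [← he']
    exact InjOn.bijOn_image fun x hx x' _ h => hY.injective x x' (hmaps hx) h
  refine BijOn.comp (BijOn.symm ⟨?_, ?_⟩ hb) (bijOn_edgeParam e)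
  · intro y hy
    exact hk.apply_apply y (he (RelCWComplex.openCell_subset_closedCell _ _ hy))
  · intro x hx
    exact hY.partialInverse_apply hk (hmaps hx)

variable [IsTopGraph X]

theorem exists_mem_graphVertices [Nonempty X] : ∃ v, v ∈ graphVertices X := by
  rcases mem_graphVertices_or (Classical.arbitrary X) with h | ⟨e, -, -, -⟩
  · exact ⟨_, h⟩
  · exact ⟨_, edgeParam_zero_mem e⟩

theorem IsInvertibleOver.exists_isPartialInverse [Nonempty X]
    (hY : IsInvertibleOver g Y) : ∃ k, IsPartialInverse g Y k := by
  obtain ⟨w₀, hw₀⟩ := exists_mem_graphVertices (X := X)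
  have : ∀ y, ∃ x, (y ∈ Y → g x = y) ∧ (y ∈ graphVertices X → x ∈ graphVertices X) := by
    intro y
    by_cases hy : y ∈ Y
    · by_cases hv : y ∈ graphVertices X
      · obtain ⟨w, hw, hwy⟩ := hY.exists_vertex y hv hy
        exact ⟨w, fun _ => hwy, fun _ => hw⟩
      · obtain ⟨x, hx⟩ := hY.exists_eq y hy
        exact ⟨x, fun _ => hx, fun h => absurd h hv⟩
    · exact ⟨w₀, fun h => absurd h hy, fun _ => hw₀⟩
  choose k hk using this
  exact ⟨k, fun y => (hk y).1, fun y => (hk y).2⟩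

/-- The inverse and the homotopy on an edge. -/
theorem IsInvertibleOver.exists_edge_data (hY : IsInvertibleOver g Y) (hg : IsProperMap g)
    (hge : IsHomotopyEquivalence g) (hk : IsPartialInverse g Y k) (δ : ∀ y, Path y (g (k y)))
    (hδ : ∀ y ∈ Y, ∀ t, δ y t = y) (e : cell (univ : Set X) 1) :
    ∃ (γ : C(I, X)) (ψ : C(I × I, X)), γ 0 = k (edgeParam e 0) ∧ γ 1 = k (edgeParam e 1) ∧
      IsEdgePath γ ∧ (∀ t, ψ (0, t) = edgeParam e t) ∧ (∀ t, ψ (1, t) = g (γ t)) ∧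
      (∀ s, ψ (s, 0) = δ (edgeParam e 0) s) ∧ (∀ s, ψ (s, 1) = δ (edgeParam e 1) s) ∧
      (closedCell 1 e ⊆ Y → (∀ t, γ t = k (edgeParam e t)) ∧ ∀ s t, ψ (s, t) = edgeParam e t) := by
  by_cases he : closedCell 1 e ⊆ Y
  · have heY : ∀ t, edgeParam e t ∈ Y := fun t => he (edgeParam_mem_closedCell e t)
    refine ⟨⟨k ∘ edgeParam e, hY.continuous_partialInverse_comp hg hk (continuous_edgeParam e) heY⟩,
      ⟨fun q => edgeParam e q.2, (continuous_edgeParam e).comp continuous_snd⟩, rfl, rfl,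
      hY.isEdgePath hg hk he, fun t => rfl, fun t => (hk.apply_apply _ (heY t)).symm,
      fun s => (hδ _ (heY 0) s).symm, fun s => (hδ _ (heY 1) s).symm,
      fun _ => ⟨fun t => rfl, fun s t => rfl⟩⟩
  -- Fullness: `q` is the class whose image under `g` makes the square with sides `e`, `δ`, `δ`
  -- commute.
  · obtain ⟨q, hq⟩ := (hge.bijective_map (k (edgeParam e 0)) (k (edgeParam e 1))).2
      ((Path.Homotopic.Quotient.mk (δ (edgeParam e 0))).symm.trans
        ((Path.Homotopic.Quotient.mk (edgeAsPath e)).trans (.mk (δ (edgeParam e 1)))))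
    obtain ⟨γ, hγ, rfl⟩ := exists_isEdgePath (hk.mem_graphVertices _ (edgeParam_zero_mem e))
      (hk.mem_graphVertices _ (edgeParam_one_mem e)) q
    have hsq : ((edgeAsPath e).trans (δ (edgeParam e 1))).Homotopic
        ((δ (edgeParam e 0)).trans (γ.map g.continuous)) := by
      rw [← Path.Homotopic.Quotient.eq, Path.Homotopic.Quotient.mk_trans,
        Path.Homotopic.Quotient.mk_trans, Path.Homotopic.Quotient.mk_map]
      simp only at hq
      rw [hq, Path.Homotopic.Quotient.trans_symm_cancel]
    obtain ⟨ψ, h1, h2, h3, h4⟩ := exists_square _ _ _ _ hsq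
    exact ⟨γ.toContinuousMap, ψ, γ.source, γ.target, hγ, h1, h2, h3, h4, fun h => absurd h he⟩

/-- A right inverse up to a homotopy that is stationary on `Y`. -/
theorem IsInvertibleOver.exists_right_inverse [ConnectedSpace X] (hY : IsInvertibleOver g Y)
    (hg : IsProperMap g) (hge : IsHomotopyEquivalence g) : ∃ g' : C(X, X), IsGraphMap g' ∧
      (∀ y ∈ Y, g (g' y) = y) ∧ ∃ H : (ContinuousMap.id X).Homotopy (g.comp g'),
        ∀ s, ∀ y ∈ Y, H (s, y) = y := by
  obtain ⟨k, hk⟩ := hY.exists_isPartialInverse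
  have := PathConnectedSpace.of_locallyPathConnectedSpace (X := X)
  have hδ : ∀ y, ∃ δ : Path y (g (k y)), y ∈ Y → ∀ t, δ t = y := by
    intro y
    by_cases hy : y ∈ Y
    · exact ⟨(Path.refl y).cast rfl (hk.apply_apply y hy), fun _ t => rfl⟩
    · exact ⟨PathConnectedSpace.somePath _ _, fun h => absurd h hy⟩
  choose δ hδ using hδ
  choose γ ψ h0 h1 hγ hψ0 hψ1 hψl hψr hst using hY.exists_edge_data hg hge hk δ hδ
  obtain ⟨g', hv, he⟩ := exists_continuousMap_glue k γ h0 h1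
  obtain ⟨F, hFv, hFe⟩ := exists_homotopy_glue (fun y => (δ y).toContinuousMap) ψ hψl hψr
  -- An edge with an interior point in `Y` lies in `Y`, so the stationary data apply to it.
  have hcell : ∀ (e : cell (univ : Set X) 1), ∀ t ∈ Ioo (0 : I) 1, edgeParam e t ∈ Y →
      closedCell 1 e ⊆ Y := fun e t ht h =>
    hY.closedCell_subset e _ (edgeParam_mem_openCell e ht) h
  refine ⟨g', ⟨fun v h => hv v h ▸ hk.mem_graphVertices v h, fun e => ?_⟩, fun y hy => ?_,
    ⟨F, fun x => ?_, fun x => ?_⟩, fun s y hy => ?_⟩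
  · have : (fun t => g' (edgeParam e t)) = γ e := funext (he e)
    rw [this]
    exact hγ e
  · rcases mem_graphVertices_or y with h | ⟨e, t, ht, rfl⟩
    · rw [hv y h, hk.apply_apply y hy]
    · rw [he, (hst e (hcell e t ht hy)).1, hk.apply_apply _ hy]
  · change F (0, x) = x
    rcases mem_graphVertices_or x with h | ⟨e, t, ht, rfl⟩
    · rw [hFv x h]
      exact (δ x).source
    · rw [hFe, hψ0]
  · change F (1, x) = g (g' x)
    rcases mem_graphVertices_or x with h | ⟨e, t, ht, rfl⟩
    · rw [hFv x h, hv x h]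
      exact (δ x).target
    · rw [hFe, hψ1, he]
  · change F (s, y) = y
    rcases mem_graphVertices_or y with h | ⟨e, t, ht, rfl⟩
    · rw [hFv y h]
      exact hδ y hy s
    · rw [hFe, (hst e (hcell e t ht hy)).2]

/-- The right inverse is a left inverse up to a homotopy that is stationary on a subgraph. -/
theorem IsInvertibleOver.exists_left_homotopy (hY : IsInvertibleOver g Y)
    (hge : IsHomotopyEquivalence g) {g' : C(X, X)} (hg' : ∀ y ∈ Y, g (g' y) = y)
    (H : (ContinuousMap.id X).Homotopy (g.comp g')) (hH : ∀ s, ∀ y ∈ Y, H (s, y) = y) :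
    ∃ G : (ContinuousMap.id X).Homotopy (g'.comp g),
      ∀ s, ∀ x ∈ largestSubgraph (g ⁻¹' Y), G (s, x) = x := by
  have hinv : ∀ x, g x ∈ Y → g' (g x) = x := fun x hx =>
    (hY.injective _ _ hx (hg' _ hx).symm).symm
  -- `ε x` lifts the track of `H` at `g x` through `g`; over `Y` that track is constant and so is
  -- the lift.
  have hε : ∀ x, ∃ ε : Path x (g' (g x)), (g x ∈ Y → ∀ t, ε t = x) ∧
      (Path.Homotopic.Quotient.mk ε).map g = .mk (H.evalAt (g x)) := by
    intro x
    by_cases hx : g x ∈ Y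
    · refine ⟨(Path.refl x).cast rfl (hinv x hx), fun _ t => rfl, ?_⟩
      rw [← Path.Homotopic.Quotient.mk_map]
      congr 1
      ext t
      exact (hH t _ hx).symm
    · obtain ⟨q, hq⟩ := (hge.bijective_map x (g' (g x))).2 (.mk (H.evalAt (g x)))
      obtain ⟨ε, rfl⟩ := Path.Homotopic.Quotient.mk_surjective q
      exact ⟨ε, fun h => absurd h hx, hq⟩
  choose ε hε hεg using hε
  have hχ : ∀ e : cell (univ : Set X) 1, ∃ χ : C(I × I, X), (∀ t, χ (0, t) = edgeParam e t) ∧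
      (∀ t, χ (1, t) = g' (g (edgeParam e t))) ∧ (∀ s, χ (s, 0) = ε (edgeParam e 0) s) ∧
      (∀ s, χ (s, 1) = ε (edgeParam e 1) s) ∧
      (closedCell 1 e ⊆ g ⁻¹' Y → ∀ s t, χ (s, t) = edgeParam e t) := by
    intro e
    by_cases he : closedCell 1 e ⊆ g ⁻¹' Y
    · have heY : ∀ t, g (edgeParam e t) ∈ Y := fun t => he (edgeParam_mem_closedCell e t)
      exact ⟨⟨fun q => edgeParam e q.2, (continuous_edgeParam e).comp continuous_snd⟩,
        fun t => rfl, fun t => (hinv _ (heY t)).symm, fun s => (hε _ (heY 0) s).symm,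
        fun s => (hε _ (heY 1) s).symm, fun _ s t => rfl⟩
    -- By faithfulness the square may be checked after applying `g`, where it is the naturality of
    -- `H` along the image of the edge.
    · have hsq : ((edgeAsPath e).trans (ε (edgeParam e 1))).Homotopic
          ((ε (edgeParam e 0)).trans ((edgeAsPath e).map (g'.comp g).continuous)) := by
        rw [← Path.Homotopic.Quotient.eq]
        apply (hge.bijective_map _ _).1
        simp only [Path.Homotopic.Quotient.mk_trans, Path.Homotopic.Quotient.map_trans, hεg]
        exact H.mk_map_trans_evalAt (.mk ((edgeAsPath e).map g.continuous))
      obtain ⟨χ, h1, h2, h3, h4⟩ := exists_square _ _ _ _ hsq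
      exact ⟨χ, h1, h2, h3, h4, fun h => absurd h he⟩
  choose χ h0 h1 hl hr hst using hχ
  obtain ⟨F, hFv, hFe⟩ := exists_homotopy_glue (fun y => (ε y).toContinuousMap) χ hl hr
  refine ⟨⟨F, fun x => ?_, fun x => ?_⟩, fun s x hx => ?_⟩
  · change F (0, x) = x
    rcases mem_graphVertices_or x with h | ⟨e, t, ht, rfl⟩
    · rw [hFv x h]
      exact (ε x).source
    · rw [hFe, h0]
  · change F (1, x) = g' (g x)
    rcases mem_graphVertices_or x with h | ⟨e, t, ht, rfl⟩
    · rw [hFv x h]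
      exact (ε x).target
    · rw [hFe, h1]
  · change F (s, x) = x
    rcases mem_graphVertices_or x with h | ⟨e, t, ht, rfl⟩
    · rw [hFv x h]
      exact hε x (largestSubgraph_subset (g ⁻¹' Y) hx) s
    · rw [hFe, hst]
      exact (closedCell_subset_of_mem_largestSubgraph (edgeParam_mem_openCell e ht) hx).trans
        (largestSubgraph_subset _)

/-- A homotopy equivalence that is invertible near infinity has a proper homotopy inverse that
inverts it near infinity. -/
theorem IsInvertibleOver.exists_isProperHomotopyInverse [ConnectedSpace X]
    (hY : IsInvertibleOver g Y) {C : Set X} (hC : IsCompact C) (hYC : Yᶜ ⊆ C)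
    (hg : IsProperMap g) (hge : IsHomotopyEquivalence g) : ∃ g' : C(X, X), IsGraphMap g' ∧
      (∀ y ∈ Y, g (g' y) = y) ∧ IsProperHomotopyInverse g g' := by
  obtain ⟨g', hgm, hg', H, hH⟩ := hY.exists_right_inverse hg hge
  obtain ⟨G, hG⟩ := hY.exists_left_homotopy hge hg' H hH
  obtain ⟨D, hD, hDG⟩ := exists_isCompact_compl_largestSubgraph (U := g ⁻¹' Y)
    (hg.isCompact_preimage hC) (by
      rw [← preimage_compl]
      exact preimage_mono hYC)
  refine ⟨g', hgm, hg', hg, ?_, ProperHomotopic.symm ⟨H, ?_⟩, ProperHomotopic.symm ⟨G, ?_⟩⟩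
  · rw [isProperMap_iff_isCompact_preimage]
    refine ⟨g'.continuous, fun K hK => (hC.union (hK.image g.continuous)).of_isClosed_subset
      (hK.isClosed.preimage g'.continuous) fun x hx => ?_⟩
    -- For `x` in `Y`, `x = g (g' x)` lies in `g '' K`, so the preimage of `K` under `g'` lies in `C
    -- ∪ g '' K`.
    by_cases hxY : x ∈ Y
    · exact .inr ⟨g' x, hx, hg' x hxY⟩
    · exact .inl (hYC hxY)
  · refine isProperMap_of_stationary hC H.toContinuousMap fun s x hx => hH s x ?_
    by_contra h
    exact hx (hYC h)
  · refine isProperMap_of_stationary hD G.toContinuousMap fun s x hx => hG s x ?_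
    by_contra h
    exact hx (hDG h)

end Inverse

/-! ## The inverse is end-periodic -/

section InverseEndPeriodic

variable {X : Type u} [TopologicalSpace X]

/-- If two consecutive terms agreed, the recursion would make the sequence constant from there on,
although it must leave every point. -/
theorem IsEndBasis.ssubset {B : ℕ → Set X} (hB : IsEndBasis X B) (φ : Set X → Set X)
    (hφ : ∀ n, B (n + 1) = φ (B n)) (n : ℕ) : B (n + 1) ⊂ B n := by
  refine ⟨hB.1 n.le_succ, fun h => ?_⟩
  have h1 : φ (B n) = B n := (hφ n).symm.trans ((hB.1 n.le_succ).antisymm h)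
  have h2 : ∀ k, B (n + k) = B n := by
    intro k
    induction k with
    | zero => rfl
    | succ k ih => rw [← add_assoc, hφ, ih, h1]
  obtain ⟨x, hx⟩ := hB.nonempty n
  obtain ⟨m, hm⟩ := hB.disjoint (isCompact_singleton (x := x))
  exact (hm (n + m) (by omega)).notMem_of_mem_left (h2 m ▸ hx) rfl

variable [CWComplex (univ : Set X)] {g g' : C(X, X)} {Y C : Set X}

theorem IsInvertibleOver.inverse_apply (hY : IsInvertibleOver g Y) (hg' : ∀ y ∈ Y, g (g' y) = y)
    {x : X} (hx : g x ∈ Y) : g' (g x) = x :=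
  (hY.injective _ _ hx (hg' _ hx).symm).symm

/-- Avoiding `g' '' C` forces every point that `g'` sends into `S` to lie in `Y`, where `g` undoes
`g'`. -/
theorem IsInvertibleOver.preimage_eq_image (hY : IsInvertibleOver g Y)
    (hg' : ∀ y ∈ Y, g (g' y) = y) (hYC : Yᶜ ⊆ C) {S : Set X}
    (hS : Disjoint S (g ⁻¹' C ∪ g' '' C)) (hSY : S ⊆ g ⁻¹' Y) : g' ⁻¹' S = g '' S := by
  ext x
  constructor
  · intro hx
    have hxY : x ∈ Y := by
      by_contra h
      exact hS.notMem_of_mem_left hx (.inr (mem_image_of_mem g' (hYC h)))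
    exact ⟨g' x, hx, hg' x hxY⟩
  · rintro ⟨s, hs, rfl⟩
    rwa [mem_preimage, hY.inverse_apply hg' (hSY hs)]

theorem IsInvertibleOver.image_eq_preimage (hY : IsInvertibleOver g Y)
    (hg' : ∀ y ∈ Y, g (g' y) = y) {S : Set X} (hSY : S ⊆ Y) : g' '' S = g ⁻¹' S := by
  ext x
  constructor
  · rintro ⟨s, hs, rfl⟩
    rwa [mem_preimage, hg' s (hSY hs)]
  · intro hx
    exact ⟨g x, hx, hY.inverse_apply hg' (hSY hx)⟩

variable [IsTopGraph X]

/-- Attracting ends of `g` are repelling for the inverse. -/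
theorem IsInvertibleOver.exists_nhd_of_attracting (hY : IsInvertibleOver g Y)
    (hg' : ∀ y ∈ Y, g (g' y) = y) (hC : IsCompact C) (hYC : Yᶜ ⊆ C) (hg : IsProperMap g) {p : ℕ}
    (hp : 0 < p) {U : Set X} {E : GraphEnd X} (hU : IsEndNhd U E)
    (hB : IsBasisOfEnd (fun n => g^[p * n] '' U) E) : ∃ W, IsEndNhd W E ∧ W ⊆ Y ∧
      g'^[p] ⁻¹' W ⊂ W ∧ IsBasisOfEnd (fun n => g'^[p * n] ⁻¹' W) E := by
  set B : ℕ → Set X := fun n => g^[p * n] '' U with hBdef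
  have hBn : ∀ n k, g^[k] '' B n = g^[p * n + k] '' U := fun n k => by
    rw [hBdef, ← image_comp, ← Function.iterate_add, add_comm]
  -- All forward images of `B n₀` must avoid the bad compact set. Multiples of `p` only move further
  -- along the basis, so excluding the preimages of that set under the first `p` iterates suffices.
  have hK : IsCompact (C ∪ ⋃ i ∈ Finset.range p, g^[i] ⁻¹' (g ⁻¹' C ∪ g' '' C)) :=
    hC.union <| (Finset.range p).isCompact_biUnion fun i _ => (hg.iterate i).isCompact_preimage
      ((hg.isCompact_preimage hC).union (hC.image g'.continuous))
  obtain ⟨n₀, hn₀⟩ := hB.1.disjoint hK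
  have hdisj : ∀ m, Disjoint (g^[m] '' B n₀) (g ⁻¹' C ∪ g' '' C) := by
    intro m
    have e : g^[m] '' B n₀ = g^[m % p] '' B (n₀ + m / p) := by
      rw [hBn, hBn, mul_add, add_assoc, Nat.div_add_mod]
    rw [e, disjoint_left]
    rintro _ ⟨x, hx, rfl⟩ hx'
    exact (hn₀ (n₀ + m / p) (Nat.le_add_right _ _)).notMem_of_mem_left hx
      (.inr (mem_iUnion₂.2 ⟨m % p, Finset.mem_range.2 (Nat.mod_lt _ hp), hx'⟩))
  have hpre : ∀ m, g'^[m] ⁻¹' B n₀ = g^[m] '' B n₀ := by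
    intro m
    induction m with
    | zero => simp
    | succ m ih =>
      rw [Function.iterate_succ, preimage_comp, ih, hY.preimage_eq_image hg' hYC (hdisj m),
        Function.iterate_succ', image_comp]
      intro x hx
      by_contra h
      exact (hdisj m).notMem_of_mem_left hx (.inl (hYC h))
  have hpre' : ∀ n, g'^[p * n] ⁻¹' B n₀ = B (n + n₀) := fun n => by
    rw [hpre, hBn, ← mul_add, add_comm]
  refine ⟨B n₀, hU.of_basis hB ?_, fun x hx => ?_, ?_, ?_⟩
  · have h0 : B 0 = U := by simp [hBdef]
    exact h0 ▸ hB.1.1 (Nat.zero_le n₀)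
  · by_contra h
    exact (hn₀ n₀ le_rfl).notMem_of_mem_left hx (.inl (hYC h))
  · have := hpre' 1
    rw [mul_one] at this
    rw [this, add_comm]
    refine hB.1.ssubset (fun S => g^[p] '' S) (fun n => ?_) n₀
    rw [hBn, ← mul_add_one]
  · simp only [hpre']
    exact hB.shift n₀

/-- Repelling ends of `g` are attracting for the inverse. -/
theorem IsInvertibleOver.exists_nhd_of_repelling (hY : IsInvertibleOver g Y)
    (hg' : ∀ y ∈ Y, g (g' y) = y) (hC : IsCompact C) (hYC : Yᶜ ⊆ C) {p : ℕ}
    (hp : 0 < p) {U : Set X} {E : GraphEnd X} (hU : IsEndNhd U E)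
    (hB : IsBasisOfEnd (fun n => g^[p * n] ⁻¹' U) E) : ∃ W, IsEndNhd W E ∧ W ⊆ Y ∧
      g'^[p] '' W ⊂ W ∧ IsBasisOfEnd (fun n => g'^[p * n] '' W) E := by
  set B : ℕ → Set X := fun n => g^[p * n] ⁻¹' U with hBdef
  have hBn : ∀ n k, g^[k] ⁻¹' B n = g^[p * n + k] ⁻¹' U := fun n k => by
    rw [hBdef, ← preimage_comp, ← Function.iterate_add]
  -- As in the attracting case, only exponents below `p` matter; here it is the preimages of `B n₀`
  -- that must avoid `C`.
  have hK : IsCompact (⋃ i ∈ Finset.range p, g^[i] '' C) :=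
    (Finset.range p).isCompact_biUnion fun i _ => hC.image (g.continuous.iterate i)
  obtain ⟨n₀, hn₀⟩ := hB.1.disjoint hK
  have hsub : ∀ m, g^[m] ⁻¹' B n₀ ⊆ Y := by
    intro m
    have e : g^[m] ⁻¹' B n₀ = g^[m % p] ⁻¹' B (n₀ + m / p) := by
      rw [hBn, hBn, mul_add, add_assoc, Nat.div_add_mod]
    rw [e]
    intro x hx
    by_contra h
    exact (hn₀ (n₀ + m / p) (Nat.le_add_right _ _)).notMem_of_mem_left hx
      (mem_iUnion₂.2 ⟨m % p, Finset.mem_range.2 (Nat.mod_lt _ hp), mem_image_of_mem _ (hYC h)⟩)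
  have him : ∀ m, g'^[m] '' B n₀ = g^[m] ⁻¹' B n₀ := by
    intro m
    induction m with
    | zero => simp
    | succ m ih =>
      rw [Function.iterate_succ', image_comp, ih, hY.image_eq_preimage hg' (hsub m),
        Function.iterate_succ, preimage_comp]
  have him' : ∀ n, g'^[p * n] '' B n₀ = B (n + n₀) := fun n => by
    rw [him, hBn, ← mul_add, add_comm]
  refine ⟨B n₀, hU.of_basis hB ?_, hsub 0, ?_, ?_⟩
  · have h0 : B 0 = U := by simp [hBdef]
    exact h0 ▸ hB.1.1 (Nat.zero_le n₀)
  · have := him' 1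
    rw [mul_one] at this
    rw [this, add_comm]
    refine hB.1.ssubset (fun S => g^[p] ⁻¹' S) (fun n => ?_) n₀
    rw [hBn, ← mul_add_one]
  · simp only [him']
    exact hB.shift n₀

/-- The new end neighborhoods lie in `Y`. There `g` is a continuous left inverse of `g'`, so `g'` is
an embedding, and edges go to edges because `g` maps an edge onto each edge of `Y`. -/
theorem IsInvertibleOver.isEndPeriodic_inverse (hY : IsInvertibleOver g Y)
    (hg' : ∀ y ∈ Y, g (g' y) = y) (hC : IsCompact C) (hYC : Yᶜ ⊆ C) (hgp : IsProperMap g)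
    (hg : IsEndPeriodic g) (hgm : IsGraphMap g') :
    IsEndPeriodic g' ∧ ∀ E : GraphEnd X, ∃ N, IsEndNhd N E ∧ N ⊆ Y := by
  obtain ⟨-, U, hU, -, -, p, hp, hdyn⟩ := hg
  have h : ∀ E, ∃ W, IsEndNhd W E ∧ W ⊆ Y ∧
      ((g'^[p] '' W ⊂ W ∧ IsBasisOfEnd (fun n => g'^[p * n] '' W) E) ∨
      (g'^[p] ⁻¹' W ⊂ W ∧ IsBasisOfEnd (fun n => g'^[p * n] ⁻¹' W) E)) := by
    intro E
    rcases hdyn E with ⟨-, hB⟩ | ⟨-, hB⟩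
    · obtain ⟨W, h1, h2, h3⟩ := hY.exists_nhd_of_attracting hg' hC hYC hgp hp (hU E) hB
      exact ⟨W, h1, h2, .inr h3⟩
    · obtain ⟨W, h1, h2, h3⟩ := hY.exists_nhd_of_repelling hg' hC hYC hp (hU E) hB
      exact ⟨W, h1, h2, .inl h3⟩
  choose W hW hWY hWdyn using h
  have hL : largestSubgraph (⋃ E, W E) ⊆ Y :=
    (largestSubgraph_subset _).trans (iUnion_subset hWY)
  refine ⟨⟨hgm, W, hW, ?_, fun e he => ?_, p, hp, hWdyn⟩, fun E => ⟨W E, hW E, hWY E⟩⟩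
  · refine IsEmbedding.of_comp (g := g) (g'.continuous.comp continuous_subtype_val) g.continuous ?_
    convert IsEmbedding.subtypeVal (p := fun x => x ∈ largestSubgraph (⋃ E, W E)) using 1
    ext x
    exact hg' x.1 (hL x.2)
  · obtain ⟨x, hx⟩ := RelCWComplex.openCell_nonempty 1 e
    have heY := hY.closedCell_subset e x hx (hL (he hx))
    obtain ⟨e', he'⟩ := hY.exists_edge e heY
    refine ⟨e', ?_⟩
    rw [← he', ← image_comp]
    refine (image_congr fun y hy => ?_).trans (image_id _)
    exact hY.inverse_apply hg' (heY (RelCWComplex.openCell_subset_closedCell _ _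
      (he' ▸ mem_image_of_mem g hy)))

end InverseEndPeriodic

theorem mainTheorem3 {X : Type u} [TopologicalSpace X] [CWComplex (univ : Set X)] [IsTopGraph X]
    [ConnectedSpace X] (hinf : ¬ RelCWComplex.Finite (univ : Set X))
    (g : C(X, X)) (hg : IsEndPeriodic g) (hge : IsHomotopyEquivalence g) :
    ∃ g' : C(X, X),
      IsHomotopyInverse g g' ∧
      IsEndPeriodic g' ∧
      (∀ E : GraphEnd X, ∃ N : Set X, IsEndNhd N E ∧ ∀ x ∈ N, g ⁻¹' {x} = {g' x}) ∧
      IsProperHomotopyInverse g g' ∧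
      ∃ (h : IsProperHomotopyEquivalence g) (h' : IsProperHomotopyEquivalence g'),
        (MappingClassGroup.mk g h)⁻¹ = MappingClassGroup.mk g' h' := by
  obtain ⟨hgp, Y, hY, C, hC, hYC⟩ := hg.exists_isInvertibleOver
  obtain ⟨g', hgm, hg', hinv⟩ := hY.exists_isProperHomotopyInverse hC hYC hgp hge
  obtain ⟨hper, hN⟩ := hY.isEndPeriodic_inverse hg' hC hYC hgp hg hgm
  refine ⟨g', ⟨?_, ?_⟩, hper, fun E => ?_, hinv, ⟨g', hinv⟩, ⟨g, hinv.symm⟩, ?_⟩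
  · obtain ⟨H, -⟩ := hinv.2.2.2
    exact ⟨H⟩
  · obtain ⟨H, -⟩ := hinv.2.2.1
    exact ⟨H⟩
  · obtain ⟨N, hN, hNY⟩ := hN E
    refine ⟨N, hN, fun x hx => ?_⟩
    ext y
    constructor
    · rintro rfl
      exact (hY.inverse_apply hg' (hNY hx)).symm
    · rintro rfl
      exact hg' x (hNY hx)
  · refine inv_eq_of_mul_eq_one_left ?_
    exact Quotient.sound hinv.2.2.2
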